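/- \textbf{Setting.} Let $d\ge 1$, $X=[0,1]^d$, $Y\subset\mathbb R^d$ compact, and let $\mu\in\mathcal P(X)$ be absolutely continuous with respect to Lebesgue measure $\mathcal L$. Let $n\ge 2$ be even. For $i\in I^n=\{0,\dots,n-1\}^d$ let $X_i=i/n+[0,1/n]^d$ (basic cells) and $m_i=\mu(X_i)$. The composite partition $\mathcal J_A$ of $I^n$ consists of the groups of $2^d$ adjacent basic cells, that is, of the classes of $i\mapsto(\lfloor i_1/2\rfloor,\dots,\lfloor i_d/2\rfloor)$. The partition $\mathcal J_B$ is the same grouping with an offset of one basic cell in every direction, that is, with $\lfloor (i_j+1)/2\rfloor$ in place of $\lfloor i_j/2\rfloor$ (its cells at the boundary of $X$ are smaller). Put $\mathcal J^{k}=\mathcal J_A$ for $k$ odd and $\mathcal J^{k}=\mathcal J_B$ for $k$ even. For a composite cell $J$ let $X_J=\bigcup_{i\in J}X_i$ and $m_J=\sum_{i\in J}m_i$. Let $\mu^n\in\mathcal P(X)$ satisfy $\mu^n(X_i)=m_i$ and $\mu^n(\partial X_i)=0$ for all $i\in I^n$. Let $\nu^n\in\mathcal P(Y)$, let $c^n:X\times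 Y\to\mathbb R$ be bounded and measurable, and let $\varepsilon^n\in[0,\infty)$. For measures $\alpha,\beta$, let $\Pi(\alpha,\beta)$ be the set of transport plans (measures with marginals $\alpha$ and $\beta$), and let $\mathrm P_Y$ denote the $Y$-marginal. Let $(\pi^{n,k})_{k\in\mathbb N}$, $\mathbb N=\{0,1,2,\dots\}$, be iterates of the domain decomposition algorithm: $\pi^{n,0}\in\Pi(\mu^n,\nu^n)$ is arbitrary and, for $k\ge1$, $\pi^{n,k}=\sum_{J\in\mathcal J^{k}}\pi^{n,k}_J$, where $\pi^{n,k}_J$ minimizes $\int c^n\,d\pi+\varepsilon^n\,\mathrm{KL}(\pi\,|\,\mu^n|_{X_J}\otimes\nu^n)$ (with $0\cdot\infty=0$) over $\pi\in\Pi\big(\mu^n|_{X_J},\mathrm P_Y(\pi^{n,k-1}|_{X_J\times Y})\big)$. Put $\nu_i^{n,k}=\mathrm P_Y(\pi^{n,k}|_{X_i\times Y})$, $\rho_i^{n,k}=\nu_i^{n,k}/m_i$ and $\rho_J^{n,k}=\frac1{m_J}\sum_{i\in J}\nu_i^{n,k}$. Let $W_Y$ be the Wasserstein-1 distance on $\mathcal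 P(Y)$. The discrete trajectory $\boldsymbol\pi^n_t$ has, at time $t\ge 0$, the fiber $\rho_J^{n,k}$ over the composite cell $X_J$, $J\in\mathcal J^{k}$, with $k=\lfloor nt\rfloor$. With this $k$, define $$\mathrm{WTV}(\boldsymbol\pi^n_t)=\sum_{\{J,J'\}\subset\mathcal J^{k}\ \text{adjacent}}\mathcal H^{d-1}(X_J\cap X_{J'})\,W_Y(\rho_J^{n,k},\rho_{J'}^{n,k}),$$ where each unordered pair of distinct cells with a common piece of boundary (that is, $\mathcal H^{d-1}(X_J\cap X_{J'})>0$) counts once, and $$\mathrm{WTVB}(\pi^{n,k})=\frac1{n^{d-1}}\sum_{\substack{i,i'\in I^n\\ i-i'\in\{2e_1,\dots,2e_d\}}}W_Y(\rho_i^{n,k},\rho_{i'}^{n,k}).$$ Finally, for open $\Omega\subset\mathbb R^d$ let $\mathrm{TV}_\Omega(u)=\sup\{\int u\,\mathrm{div}\,\phi\,dx : \phi\in C^1_c(\Omega;\mathbb R^d),\ |\phi|\le1\}$. Let $\Omega$ be either $\mathbb R^d$ (with $\frac{d\mu}{d\mathcal L}$ extended by zero outside $X$) or the open cube $(0,1)^d$.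 \textbf{Proposition.} Assume that $\frac{d\mu}{d\mathcal L}\ge M_l$ almost everywhere on $X$ for some $M_l>0$ and that $\mathrm{TV}_\Omega(\frac{d\mu}{d\mathcal L})<\infty$. Then, for every $k\in\mathbb N$, $$\mathrm{WTV}(\boldsymbol\pi^n_{k/n})\le\tfrac12\,\mathrm{WTVB}(\pi^{n,k})+d\cdot\operatorname{diam}Y\cdot\Big[2^{2d}+2^d\,\frac{\sqrt d}{M_l}\,\mathrm{TV}_\Omega\Big(\frac{d\mu}{d\mathcal L}\Big)\Big].$$ -/

import Mathlib

open MeasureTheory Set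
open scoped ENNReal NNReal

noncomputable section

namespace DomDec

/-- Euclidean space `ℝ^d`. -/
abbrev E (d : ℕ) : Type := EuclideanSpace ℝ (Fin d)

/-- The domain `X = [0,1]^d`. -/
def unitCube (d : ℕ) : Set (E d) := {x | ∀ j, 0 ≤ x j ∧ x j ≤ 1}

/-- Index set of the basic cells at level `n`: multi-indices in `{0, …, n-1}^d`. -/
abbrev Idx (d n : ℕ) : Type := Fin d → Fin n

/-- The closed basic cell `i/n + [0,1/n]^d`. -/
def basicCell {d n : ℕ} (i : Idx d n) : Set (E d) :=
  {x | ∀ j, ((i j : ℕ) : ℝ) / n ≤ x j ∧ x j ≤ (((i j : ℕ) : ℝ) + 1) / n}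

/-- The region `X_J` covered by a set `J` of basic cells. -/
def cellRegion {d n : ℕ} (J : Finset (Idx d n)) : Set (E d) := ⋃ i ∈ J, basicCell i

/-- The partition of the basic cells into groups of `2^d` adjacent cells, shifted by `s` cells in
every direction: `i` and `i'` lie in the same group iff `⌊(i_j + s)/2⌋ = ⌊(i'_j + s)/2⌋` for
all `j`. (Groups at the boundary may be smaller.) -/
def shiftedPartition (d n s : ℕ) : Finset (Finset (Idx d n)) :=
  Finset.univ.image fun i : Idx d n =>
    Finset.univ.filter fun i' : Idx d n => ∀ j, ((i' j : ℕ) + s) / 2 = ((i j : ℕ) + s) / 2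

/-- The composite partition `𝒥_A`. -/
def partitionA (d n : ℕ) : Finset (Finset (Idx d n)) := shiftedPartition d n 0

/-- The composite partition `𝒥_B`: same as `𝒥_A`, with an offset of one basic cell. -/
def partitionB (d n : ℕ) : Finset (Finset (Idx d n)) := shiftedPartition d n 1

/-- The composite partition used in iteration `k`: `𝒥_A` if `k` is odd, `𝒥_B` if `k` is even. -/
def iterPartition (d n k : ℕ) : Finset (Finset (Idx d n)) :=
  if Odd k then partitionA d n else partitionB d n

/-- `Π(μ,ν)`: the transport plans between `μ` and `ν`. -/
def plans {A B : Type*} [MeasurableSpace A] [MeasurableSpace B] (μ : Measure A) (ν : Measure B) :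
    Set (Measure (A × B)) :=
  {π | π.map Prod.fst = μ ∧ π.map Prod.snd = ν}

/-- The Wasserstein-1 distance `inf_{γ ∈ Π(ρ,σ)} ∫ d(y,y') dγ(y,y')`. -/
def wasserstein {Y : Type*} [PseudoEMetricSpace Y] [MeasurableSpace Y] (ρ σ : Measure Y) : ℝ≥0∞ :=
  ⨅ γ ∈ plans ρ σ, ∫⁻ p, edist p.1 p.2 ∂γ

/-- The partial `Y`-marginal `P_Y (π ⌞ (S × Y))`. -/
def partialMarginal {d : ℕ} {Y : Type*} [MeasurableSpace Y] (π : Measure (E d × Y))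
    (S : Set (E d)) : Measure Y :=
  (π.restrict (S ×ˢ univ)).map Prod.snd

/-- The entropic transport objective `∫ c dπ + ε KL(π | ref)`, with the convention `0 · ∞ = 0`. -/
def entropicCost {Z : Type*} [MeasurableSpace Z] (c : Z → ℝ) (ε : ℝ≥0) (ref π : Measure Z) :
    EReal :=
  ((∫ z, c z ∂π : ℝ) : EReal) + (((ε : ℝ≥0∞) * InformationTheory.klDiv π ref : ℝ≥0∞) : EReal)

/-- `πs 0, πs 1, …` are iterates of the domain decomposition algorithm for the (entropic)
transport problem with marginals `μn`, `νn`, cost `c` and regularization `ε`: the start is a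
transport plan, and iteration `k + 1` replaces the plan on each composite cell `J` of the
current partition by a minimizer with the same marginals on that cell. -/
def IsDomDecIterates {d : ℕ} {Y : Type*} [MeasurableSpace Y] (n : ℕ) (c : E d × Y → ℝ) (ε : ℝ≥0)
    (μn : Measure (E d)) (νn : Measure Y) (πs : ℕ → Measure (E d × Y)) : Prop :=
  πs 0 ∈ plans μn νn ∧
  ∀ k : ℕ, ∃ πc : Finset (Idx d n) → Measure (E d × Y),
    (∀ J ∈ iterPartition d n (k + 1),
      πc J ∈ plans (μn.restrict (cellRegion J)) (partialMarginal (πs k) (cellRegion J)) ∧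
      IsMinOn (entropicCost c ε ((μn.restrict (cellRegion J)).prod νn))
        (plans (μn.restrict (cellRegion J)) (partialMarginal (πs k) (cellRegion J))) (πc J)) ∧
    πs (k + 1) = ∑ J ∈ iterPartition d n (k + 1), πc J

/-- The mass `m_i = μ(X_i)` of a basic cell. -/
def basicMass {d n : ℕ} (μ : Measure (E d)) (i : Idx d n) : ℝ≥0∞ := μ (basicCell i)

/-- The mass `m_J = ∑_{i ∈ J} m_i` of a composite cell. -/
def compositeMass {d n : ℕ} (μ : Measure (E d)) (J : Finset (Idx d n)) : ℝ≥0∞ :=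
  ∑ i ∈ J, basicMass μ i

/-- The normalized partial marginal `ρ_i = ν_i / m_i` of a basic cell. -/
def basicRho {d n : ℕ} {Y : Type*} [MeasurableSpace Y] (μ : Measure (E d))
    (π : Measure (E d × Y)) (i : Idx d n) : Measure Y :=
  (basicMass μ i)⁻¹ • partialMarginal π (basicCell i)

/-- The normalized partial marginal `ρ_J = ν_J / m_J` of a composite cell, `ν_J = ∑_{i ∈ J} ν_i`. -/
def compositeRho {d n : ℕ} {Y : Type*} [MeasurableSpace Y] (μ : Measure (E d))
    (π : Measure (E d × Y)) (J : Finset (Idx d n)) : Measure Y :=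
  (compositeMass μ J)⁻¹ • ∑ i ∈ J, partialMarginal π (basicCell i)

/-- The area `ℋ^{d-1}(X_J ∩ X_{J'})` of the interface of two composite cells. The measure `μHE` is
the Hausdorff measure in its usual normalization (it agrees with Lebesgue measure on `ℝ^{d-1}`). -/
def interfaceArea {d n : ℕ} (J J' : Finset (Idx d n)) : ℝ≥0∞ :=
  (Measure.euclideanHausdorffMeasure (d - 1) : Measure (E d)) (cellRegion J ∩ cellRegion J')

/-- Two distinct composite cells are adjacent if they share a piece of boundary. -/
def Adjacent {d n : ℕ} (J J' : Finset (Idx d n)) : Prop := J ≠ J' ∧ 0 < interfaceArea J J'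

open Classical in
/-- The Wasserstein total variation at time `t` of the discrete trajectory at level `n` built from
the iterates `πs`. This trajectory has the value `ρ_J^k` on the composite cell `X_J`, where
`k = ⌊t n⌋` and `J` runs through the `k`-th partition. Each pair of adjacent cells counts once: the
sum below is over ordered pairs and is halved. -/
def wtv {d : ℕ} {Y : Type*} [PseudoEMetricSpace Y] [MeasurableSpace Y] (n : ℕ)
    (μ : Measure (E d)) (πs : ℕ → Measure (E d × Y)) (t : ℝ) : ℝ≥0∞ :=
  let k : ℕ := ⌊t * n⌋₊
  2⁻¹ * ∑ J ∈ iterPartition d n k, ∑ J' ∈ iterPartition d n k,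
    if Adjacent J J' then
      interfaceArea J J' * wasserstein (compositeRho μ (πs k) J) (compositeRho μ (πs k) J')
    else 0

open Classical in
/-- The basic-cell 'skip one' Wasserstein total variation: the sum is over the pairs of basic cells
with `i - i' ∈ {2e_1, …, 2e_d}`. -/
def wtvb {d : ℕ} {Y : Type*} [PseudoEMetricSpace Y] [MeasurableSpace Y] (n : ℕ)
    (μ : Measure (E d)) (π : Measure (E d × Y)) : ℝ≥0∞ :=
  ((n : ℝ≥0∞) ^ (d - 1))⁻¹ * ∑ i : Idx d n, ∑ i' : Idx d n,
    if ∃ j : Fin d, (fun l => ((i l : ℕ) : ℤ) - ((i' l : ℕ) : ℤ)) = Pi.single j 2 then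
      wasserstein (basicRho μ π i) (basicRho μ π i')
    else 0

/-- The divergence of a vector field on `ℝ^d`. -/
def divergence {d : ℕ} (φ : E d → E d) (x : E d) : ℝ :=
  ∑ j, (fderiv ℝ φ x (EuclideanSpace.single j 1)) j

/-- The total variation of `u` in the open set `Ω`:
`sup {∫ u div φ | φ ∈ C_c^1(Ω; ℝ^d), |φ| ≤ 1}`. -/
def totalVariation {d : ℕ} (Ω : Set (E d)) (u : E d → ℝ) : ℝ≥0∞ :=
  ⨆ φ ∈ {φ : E d → E d | ContDiff ℝ 1 φ ∧ HasCompactSupport φ ∧ tsupport φ ⊆ Ω ∧ ∀ x, ‖φ x‖ ≤ 1},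
    ENNReal.ofReal (∫ x, u x * divergence φ x)

/-- The Lebesgue density of `μ`, as a real function on `ℝ^d`. -/
def density {d : ℕ} (μ : Measure (E d)) (x : E d) : ℝ := (μ.rnDeriv volume x).toReal

end DomDec

end

/-! Two adjacent composite cells `J`, `J'` share a face orthogonal to some `e_j`. If both have width
two in direction `j`, then `i ↦ i - 2e_j` maps `J` bijectively onto `J'`. The measures `ρ_J`,
`ρ_{J'}` are mixtures of the basic `ρ_i` with weights `m_i/m_J`. If all weights were `1/|J|`,
transport within the pairs would cost at most `1/|J|` times the sum of the `W(ρ_i, ρ_{i-2e_j})`. The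
face has area at most `|J|/(2n^{d-1})`, so the product carries the factor `1/(2n^{d-1})`, and
summation gives half of WTVB (`IsNext.cost_le`, `sum_skipCost_le`).

There are two errors. First, the weights are not equal. The unmatched mass travels at most `diam Y`,
which costs `diam Y` times the ℓ¹-distance of the weights from `1/|J|` (`wasserstein_mixture_le`).
Since `m_J ≥ M_l |J| n^{-d}`, this distance is controlled by the deviation of the `m_i` from their
mean over `J`. Averaging over coordinate flips and telescoping reduces the deviation to differences
of neighbouring masses (`sum_abs_sub_flipMean_le`). These are bounded by `TV/n` in each direction,
by testing the density with a signed sum of hats of disjoint supports, whose divergence is `n` times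
a difference of smoothed cell indicators (`sum_lowerCells_le`). Second, a cell of width one in
direction `j` has no such bijection. These cells fill at most two boundary layers, that is,
`2n^{d-1}` basic cells, and there the diameter bound suffices.

In each direction a composite cell is charged at most twice, as the upper and as the lower partner.
The errors add up to `d · diam Y · (4 + 2d TV/M_l)`, and `4 ≤ 2^{2d}`, `2d ≤ 2^d √d` give the stated
constant. The algorithm enters through the conservation of the basic masses
(`IsDomDecIterates.partialMarginal_univ`), which makes every `ρ_i` a probability measure. -/

namespace DomDec

/-! ### Wasserstein-1 distance of measures of arbitrary mass -/

section Wasserstein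

variable {Y : Type*} [PseudoEMetricSpace Y] [MeasurableSpace Y]

theorem wasserstein_le_of_mem_plans {ρ σ : Measure Y} {γ : Measure (Y × Y)} (h : γ ∈ plans ρ σ) :
    wasserstein ρ σ ≤ ∫⁻ p, edist p.1 p.2 ∂γ :=
  iInf₂_le γ h

theorem wasserstein_le_swap [OpensMeasurableSpace Y] [SecondCountableTopology Y]
    (ρ σ : Measure Y) : wasserstein ρ σ ≤ wasserstein σ ρ := by
  refine le_iInf₂ fun γ hγ => ?_
  have h : γ.map Prod.swap ∈ plans ρ σ := by
    constructor
    · rw [Measure.map_map measurable_fst measurable_swap]; exact hγ.2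
    · rw [Measure.map_map measurable_snd measurable_swap]; exact hγ.1
  refine (wasserstein_le_of_mem_plans h).trans ?_
  rw [lintegral_map measurable_edist measurable_swap]
  simp [edist_comm]

theorem wasserstein_comm [OpensMeasurableSpace Y] [SecondCountableTopology Y]
    (ρ σ : Measure Y) : wasserstein ρ σ = wasserstein σ ρ :=
  le_antisymm (wasserstein_le_swap ρ σ) (wasserstein_le_swap σ ρ)

theorem wasserstein_zero : wasserstein (0 : Measure Y) 0 = 0 := by
  have h : (0 : Measure (Y × Y)) ∈ plans (0 : Measure Y) 0 := by simp [plans]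
  simpa using wasserstein_le_of_mem_plans h

/-- Couplings of the parts add up to a coupling of the sums. No normalization is imposed, so a
probability measure may be split into pieces that are transported separately. -/
theorem wasserstein_add_le (ρ σ ρ' σ' : Measure Y) :
    wasserstein (ρ + ρ') (σ + σ') ≤ wasserstein ρ σ + wasserstein ρ' σ' := by
  refine ENNReal.le_iInf₂_add_iInf₂ fun γ hγ γ' hγ' => ?_
  have h : γ + γ' ∈ plans (ρ + ρ') (σ + σ') := by
    constructor
    · rw [Measure.map_add _ _ measurable_fst, hγ.1, hγ'.1]
    · rw [Measure.map_add _ _ measurable_snd, hγ.2, hγ'.2]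
  exact (wasserstein_le_of_mem_plans h).trans (lintegral_add_measure _ _ _).le

theorem wasserstein_sum_le {ι : Type*} (s : Finset ι) (ρ σ : ι → Measure Y) :
    wasserstein (∑ i ∈ s, ρ i) (∑ i ∈ s, σ i) ≤ ∑ i ∈ s, wasserstein (ρ i) (σ i) := by
  classical
  induction s using Finset.induction_on with
  | empty => simp [wasserstein_zero]
  | insert a s ha ih =>
    rw [Finset.sum_insert ha, Finset.sum_insert ha, Finset.sum_insert ha]
    exact (wasserstein_add_le _ _ _ _).trans (by gcongr)

theorem wasserstein_smul_le (c : ℝ≥0∞) (hc : c ≠ ∞) (ρ σ : Measure Y) :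
    wasserstein (c • ρ) (c • σ) ≤ c * wasserstein ρ σ := by
  rcases eq_or_ne c 0 with rfl | hc0
  · simp [wasserstein_zero]
  unfold wasserstein
  rw [ENNReal.mul_iInf_of_ne hc0 hc]
  refine le_iInf fun γ => ?_
  rw [ENNReal.mul_iInf_of_ne hc0 hc]
  refine le_iInf fun hγ => ?_
  have h : c • γ ∈ plans (c • ρ) (c • σ) := by
    constructor
    · rw [Measure.map_smul, hγ.1]
    · rw [Measure.map_smul, hγ.2]
  exact (wasserstein_le_of_mem_plans h).trans (lintegral_smul_measure _ _).le

/-- The product measure divided by the common mass is a coupling, and no point travels farther than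
`D`. -/
theorem wasserstein_le_diam_mul {D : ℝ≥0∞} (hD : ∀ x y : Y, edist x y ≤ D)
    {ρ σ : Measure Y} [IsFiniteMeasure ρ] [IsFiniteMeasure σ] (h : ρ univ = σ univ) :
    wasserstein ρ σ ≤ D * ρ univ := by
  rcases eq_or_ne (ρ univ) 0 with h0 | h0
  · rw [Measure.measure_univ_eq_zero.1 h0, Measure.measure_univ_eq_zero.1 (h.symm.trans h0)]
    simp [wasserstein_zero]
  have hf : ρ univ ≠ ∞ := measure_ne_top _ _
  have hmem : (ρ univ)⁻¹ • ρ.prod σ ∈ plans ρ σ := by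
    constructor
    · rw [Measure.map_smul, Measure.map_fst_prod, ← h, smul_smul,
        ENNReal.inv_mul_cancel h0 hf, one_smul]
    · rw [Measure.map_smul, Measure.map_snd_prod, smul_smul,
        ENNReal.inv_mul_cancel h0 hf, one_smul]
  refine (wasserstein_le_of_mem_plans hmem).trans ?_
  calc _ ≤ ∫⁻ _, D ∂((ρ univ)⁻¹ • ρ.prod σ) := lintegral_mono fun p => hD _ _
    _ = D * ρ univ := by
      rw [lintegral_const, Measure.smul_apply, ← univ_prod_univ, Measure.prod_prod, ← h,
        smul_eq_mul, ← mul_assoc (ρ univ)⁻¹, ENNReal.inv_mul_cancel h0 hf, one_mul]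

/-- Two mixtures with weights `w`, `w'` of probability measures: the part of the mass which is
common to both of them and below `v` is transported within the pairs, the rest arbitrarily. -/
theorem wasserstein_mixture_le {D : ℝ} (hD0 : 0 ≤ D)
    (hD : ∀ x y : Y, edist x y ≤ ENNReal.ofReal D)
    {ι : Type*} (s : Finset ι) (w w' : ι → ℝ) (v : ℝ) (hv : 0 ≤ v)
    (hw : ∀ i ∈ s, 0 ≤ w i) (hw' : ∀ i ∈ s, 0 ≤ w' i)
    (hw1 : ∑ i ∈ s, w i = 1) (hw1' : ∑ i ∈ s, w' i = 1) (hv1 : ∑ _i ∈ s, v = 1)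
    (ρ ρ' : ι → Measure Y) (hρ : ∀ i ∈ s, IsProbabilityMeasure (ρ i))
    (hρ' : ∀ i ∈ s, IsProbabilityMeasure (ρ' i)) :
    wasserstein (∑ i ∈ s, ENNReal.ofReal (w i) • ρ i) (∑ i ∈ s, ENNReal.ofReal (w' i) • ρ' i) ≤
      ENNReal.ofReal v * ∑ i ∈ s, wasserstein (ρ i) (ρ' i) +
        ENNReal.ofReal (D * (∑ i ∈ s, |w i - v| + ∑ i ∈ s, |w' i - v|)) := by
  -- The mass `u i` moves from `ρ i` to `ρ' i`. The cap at `v` makes the coefficient of the pair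
  -- costs uniform; the remainders of both mixtures have the same mass `1 - ∑ u i`.
  set u : ι → ℝ := fun i => min v (min (w i) (w' i)) with hu
  have hu0 : ∀ i ∈ s, 0 ≤ u i := fun i hi => le_min hv (le_min (hw i hi) (hw' i hi))
  have huw : ∀ i, u i ≤ w i := fun i => (min_le_right _ _).trans (min_le_left _ _)
  have huw' : ∀ i, u i ≤ w' i := fun i => (min_le_right _ _).trans (min_le_right _ _)
  have huv : ∀ i, u i ≤ v := fun i => min_le_left _ _
  have split : ∀ (q : ι → ℝ) (τ : ι → Measure Y), (∀ i, u i ≤ q i) →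
      ∑ i ∈ s, ENNReal.ofReal (q i) • τ i = ∑ i ∈ s, ENNReal.ofReal (u i) • τ i +
        ∑ i ∈ s, ENNReal.ofReal (q i - u i) • τ i := by
    intro q τ hq
    rw [← Finset.sum_add_distrib]
    refine Finset.sum_congr rfl fun i hi => ?_
    rw [← add_smul, ← ENNReal.ofReal_add (hu0 i hi) (sub_nonneg.2 (hq i)), add_sub_cancel]
  have mass : ∀ (q : ι → ℝ) (τ : ι → Measure Y), (∀ i, u i ≤ q i) → ∑ i ∈ s, q i = 1 →
      (∀ i ∈ s, IsProbabilityMeasure (τ i)) →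
      (∑ i ∈ s, ENNReal.ofReal (q i - u i) • τ i) univ = ENNReal.ofReal (1 - ∑ i ∈ s, u i) := by
    intro q τ hq hq1 hτ
    rw [Measure.finsetSum_apply, ← hq1, ← Finset.sum_sub_distrib,
      ENNReal.ofReal_sum_of_nonneg fun i _ => sub_nonneg.2 (hq i)]
    refine Finset.sum_congr rfl fun i hi => ?_
    have := hτ i hi
    simp
  have fin : ∀ (q : ι → ℝ) (τ : ι → Measure Y), (∀ i, u i ≤ q i) → ∑ i ∈ s, q i = 1 →
      (∀ i ∈ s, IsProbabilityMeasure (τ i)) →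
      IsFiniteMeasure (∑ i ∈ s, ENNReal.ofReal (q i - u i) • τ i) := fun q τ hq hq1 hτ =>
    ⟨by rw [mass q τ hq hq1 hτ]; exact ENNReal.ofReal_lt_top⟩
  have := fin w ρ huw hw1 hρ
  have := fin w' ρ' huw' hw1' hρ'
  rw [split w ρ huw, split w' ρ' huw']
  refine (wasserstein_add_le _ _ _ _).trans (add_le_add ?_ ?_)
  · refine (wasserstein_sum_le _ _ _).trans ?_
    rw [Finset.mul_sum]
    refine Finset.sum_le_sum fun i _ => (wasserstein_smul_le _ ENNReal.ofReal_ne_top _ _).trans ?_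
    gcongr
    exact huv i
  · refine (wasserstein_le_diam_mul hD ?_).trans ?_
    · rw [mass w ρ huw hw1 hρ, mass w' ρ' huw' hw1' hρ']
    · rw [mass w ρ huw hw1 hρ, ← ENNReal.ofReal_mul hD0]
      refine ENNReal.ofReal_le_ofReal (mul_le_mul_of_nonneg_left ?_ hD0)
      -- Writing `1` as `∑ v` reduces the bound on the remaining mass to `v - u i ≤ |w i - v| + |w'
      -- i - v|`.
      rw [← hv1, ← Finset.sum_sub_distrib, ← Finset.sum_add_distrib]
      refine Finset.sum_le_sum fun i _ => ?_
      have h1 := neg_abs_le (w i - v)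
      have h2 := neg_abs_le (w' i - v)
      have h3 := abs_nonneg (w i - v)
      have h4 := abs_nonneg (w' i - v)
      have : v - |w i - v| - |w' i - v| ≤ u i := le_min (by linarith) (le_min (by linarith) (by linarith))
      linarith

end Wasserstein

/-! ### Basic cells, their grouping, and conservation of mass -/

section Cells

variable {d n : ℕ}

theorem isClosed_basicCell (i : Idx d n) : IsClosed (basicCell i) := by
  have : basicCell i = ⋂ j, {x : E d | ((i j : ℕ) : ℝ) / n ≤ x j} ∩
      {x | x j ≤ (((i j : ℕ) : ℝ) + 1) / n} := by
    ext x; simp [basicCell]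
  rw [this]
  exact isClosed_iInter fun j =>
    (isClosed_le continuous_const (by fun_prop)).inter (isClosed_le (by fun_prop) continuous_const)

theorem measurableSet_basicCell (i : Idx d n) : MeasurableSet (basicCell i) :=
  (isClosed_basicCell i).measurableSet

/-- From a point on a face, a small step along `e_l` or `-e_l` leaves the cell, so the point is not
interior. -/
theorem mem_frontier_basicCell {i : Idx d n} {x : E d} (hx : x ∈ basicCell i) {l : Fin d}
    (hl : x l = ((i l : ℕ) : ℝ) / n ∨ x l = (((i l : ℕ) : ℝ) + 1) / n) :
    x ∈ frontier (basicCell i) := by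
  rw [(isClosed_basicCell i).frontier_eq]
  refine ⟨hx, fun hint => ?_⟩
  have hcont : Continuous fun t : ℝ => x + t • (EuclideanSpace.single l (1 : ℝ) : E d) := by
    fun_prop
  have h0 : (fun t : ℝ => x + t • (EuclideanSpace.single l (1 : ℝ) : E d)) ⁻¹' basicCell i
      ∈ nhds (0 : ℝ) := by
    apply hcont.continuousAt
    simpa using mem_interior_iff_mem_nhds.1 hint
  obtain ⟨δ, hδ, hball⟩ := Metric.mem_nhds_iff.1 h0
  have hp : δ / 2 ∈ Metric.ball (0 : ℝ) δ := by
    rw [Metric.mem_ball, Real.dist_eq, sub_zero, abs_of_pos (half_pos hδ)]; linarith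
  have hm : -(δ / 2) ∈ Metric.ball (0 : ℝ) δ := by
    rw [Metric.mem_ball, Real.dist_eq, sub_zero, abs_neg, abs_of_pos (half_pos hδ)]; linarith
  have h1 := hball hp l
  have h2 := hball hm l
  simp at h1 h2
  rcases hl with hl | hl <;> rw [hl] at h1 h2 <;> linarith

theorem basicCell_inter_subset_frontier {i i' : Idx d n} (h : i ≠ i') :
    basicCell i ∩ basicCell i' ⊆ frontier (basicCell i) := by
  rintro x ⟨hx, hx'⟩
  obtain ⟨l, hl⟩ := Function.ne_iff.1 h
  refine mem_frontier_basicCell hx (l := l) ?_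
  have hn : (0 : ℝ) < n := by exact_mod_cast (i l).pos
  have h1 := hx l
  have h2 := hx' l
  rcases lt_or_gt_of_ne (fun he => hl (Fin.ext he) : (i l : ℕ) ≠ i' l) with hlt | hlt
  · right
    refine le_antisymm h1.2 (le_trans ?_ h2.1)
    have : ((i l : ℕ) : ℝ) + 1 ≤ (i' l : ℕ) := by exact_mod_cast hlt
    gcongr
  · left
    refine le_antisymm (h2.2.trans ?_) h1.1
    have : ((i' l : ℕ) : ℝ) + 1 ≤ (i l : ℕ) := by exact_mod_cast hlt
    gcongr

/-- The composite cell of the shifted partition which contains `i`. -/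
def block (s : ℕ) (i : Idx d n) : Finset (Idx d n) :=
  Finset.univ.filter fun i' : Idx d n => ∀ j, ((i' j : ℕ) + s) / 2 = ((i j : ℕ) + s) / 2

theorem mem_block {s : ℕ} {i i' : Idx d n} :
    i' ∈ block s i ↔ ∀ j, ((i' j : ℕ) + s) / 2 = ((i j : ℕ) + s) / 2 := by
  simp [block]

theorem self_mem_block (s : ℕ) (i : Idx d n) : i ∈ block s i := mem_block.2 fun _ => rfl

theorem block_eq_of_mem {s : ℕ} {i i' : Idx d n} (h : i' ∈ block s i) : block s i' = block s i := by
  ext k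
  rw [mem_block] at h
  simp [mem_block, h]

theorem mem_shiftedPartition {s : ℕ} {J : Finset (Idx d n)} :
    J ∈ shiftedPartition d n s ↔ ∃ i, block s i = J := by
  simp [shiftedPartition, block]

theorem block_mem (s : ℕ) (i : Idx d n) : block s i ∈ shiftedPartition d n s :=
  mem_shiftedPartition.2 ⟨i, rfl⟩

theorem eq_block {s : ℕ} {J : Finset (Idx d n)} (hJ : J ∈ shiftedPartition d n s) {i : Idx d n}
    (hi : i ∈ J) : J = block s i := by
  obtain ⟨i', rfl⟩ := mem_shiftedPartition.1 hJ
  exact (block_eq_of_mem hi).symm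

theorem sum_shiftedPartition {M : Type*} [AddCommMonoid M] (s : ℕ) (f : Idx d n → M) :
    ∑ J ∈ shiftedPartition d n s, ∑ i ∈ J, f i = ∑ i, f i := by
  rw [← Finset.sum_fiberwise_of_maps_to (g := block s) (fun i _ => block_mem s i)]
  refine Finset.sum_congr rfl fun J hJ => Finset.sum_congr ?_ fun _ _ => rfl
  ext i
  simp only [Finset.mem_filter, Finset.mem_univ, true_and]
  exact ⟨fun hi => (eq_block hJ hi).symm, fun h => by rw [← h]; exact self_mem_block s i⟩

theorem exists_iterPartition_eq (d n k : ℕ) :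
    ∃ s, iterPartition d n k = shiftedPartition d n s := by
  unfold iterPartition
  split_ifs
  · exact ⟨0, rfl⟩
  · exact ⟨1, rfl⟩

theorem cellRegion_inter_null {μn : Measure (E d)}
    (hb : ∀ i : Idx d n, μn (frontier (basicCell i)) = 0) {i : Idx d n} {J : Finset (Idx d n)}
    (hi : i ∉ J) : μn (basicCell i ∩ cellRegion J) = 0 := by
  refine measure_mono_null ?_ (hb i)
  rintro x ⟨hx, hxJ⟩
  simp only [cellRegion, mem_iUnion] at hxJ
  obtain ⟨i', hi', hx'⟩ := hxJ
  exact basicCell_inter_subset_frontier (fun h => hi (by rw [h]; exact hi')) ⟨hx, hx'⟩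

theorem partialMarginal_univ {Y : Type*} [MeasurableSpace Y] (π : Measure (E d × Y))
    {S : Set (E d)} (hS : MeasurableSet S) :
    partialMarginal π S univ = π.map Prod.fst S := by
  rw [partialMarginal, Measure.map_apply measurable_snd MeasurableSet.univ, preimage_univ,
    Measure.restrict_apply MeasurableSet.univ, univ_inter, Measure.map_apply measurable_fst hS,
    prod_univ]

/-- The iterates keep the mass of every basic cell. -/
theorem IsDomDecIterates.partialMarginal_univ {Y : Type*} [MeasurableSpace Y]
    {c : E d × Y → ℝ} {ε : ℝ≥0} {μn : Measure (E d)} {νn : Measure Y}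
    {πs : ℕ → Measure (E d × Y)} (hπ : IsDomDecIterates n c ε μn νn πs)
    (hb : ∀ i : Idx d n, μn (frontier (basicCell i)) = 0) (k : ℕ) (i : Idx d n) :
    partialMarginal (πs k) (basicCell i) univ = μn (basicCell i) := by
  rw [DomDec.partialMarginal_univ _ (measurableSet_basicCell i)]
  cases k with
  | zero => rw [hπ.1.1]
  | succ k =>
    obtain ⟨πc, hπc, hsum⟩ := hπ.2 k
    obtain ⟨s, hs⟩ := exists_iterPartition_eq d n (k + 1)
    rw [hs] at hπc hsum
    rw [hsum, Measure.map_apply measurable_fst (measurableSet_basicCell i),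
      Measure.finsetSum_apply]
    have h : ∀ J ∈ shiftedPartition d n s, πc J (Prod.fst ⁻¹' basicCell i) =
        μn (basicCell i ∩ cellRegion J) := fun J hJ => by
      rw [← Measure.map_apply measurable_fst (measurableSet_basicCell i), (hπc J hJ).1.1,
        Measure.restrict_apply (measurableSet_basicCell i)]
    -- The composite cell containing `i` contributes all of `X_i`; every other one meets `X_i`
    -- inside its frontier, which is `μn`-null.
    rw [Finset.sum_congr rfl h, Finset.sum_eq_single (block s i)]
    · rw [inter_eq_left.2]
      exact subset_biUnion_of_mem (u := basicCell) (self_mem_block s i)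
    · exact fun J hJ hne => cellRegion_inter_null hb fun hi => hne (eq_block hJ hi)
    · exact fun h => absurd (block_mem s i) h

end Cells

/-! ### Masses of the basic cells -/

section Mass

variable {d n : ℕ}

/-- The interior of a basic cell, in coordinates. -/
def openCell (i : Idx d n) : Set (E d) :=
  {x | ∀ j, ((i j : ℕ) : ℝ) / n < x j ∧ x j < (((i j : ℕ) : ℝ) + 1) / n}

theorem volume_hyperplane (j : Fin d) (t : ℝ) : volume {x : E d | x j = t} = 0 := by
  have h : {x : E d | x j = t} = WithLp.ofLp ⁻¹' {f : Fin d → ℝ | f j = t} := rfl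
  rw [h, (PiLp.volume_preserving_ofLp (Fin d)).measure_preimage]
  · rw [volume_pi]; exact Measure.pi_hyperplane (fun _ : Fin d => (volume : Measure ℝ)) j t
  · exact (measurableSet_eq_fun (measurable_pi_apply j) measurable_const).nullMeasurableSet

theorem volume_box (a b : Fin d → ℝ) :
    volume {x : E d | ∀ j, a j ≤ x j ∧ x j ≤ b j} = ∏ j, ENNReal.ofReal (b j - a j) := by
  have h : {x : E d | ∀ j, a j ≤ x j ∧ x j ≤ b j} = WithLp.ofLp ⁻¹' (Icc a b) := by
    ext x; simp [Pi.le_def, forall_and]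
  rw [h, (PiLp.volume_preserving_ofLp (Fin d)).measure_preimage
    measurableSet_Icc.nullMeasurableSet, Real.volume_Icc_pi]

theorem measure_openCell {μ : Measure (E d)} (hμ : μ ≪ volume) (i : Idx d n) :
    μ (openCell i) = basicMass μ i := by
  refine le_antisymm (measure_mono fun x hx j => ⟨(hx j).1.le, (hx j).2.le⟩) ?_
  have hsub : basicCell i ⊆ openCell i ∪ ⋃ j, ({x : E d | x j = ((i j : ℕ) : ℝ) / n} ∪
      {x | x j = (((i j : ℕ) : ℝ) + 1) / n}) := by
    intro x hx
    by_contra hcon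
    simp only [mem_union, mem_iUnion, mem_ofPred_eq, not_or, not_exists] at hcon
    exact hcon.1 fun j => ⟨lt_of_le_of_ne (hx j).1 (Ne.symm (hcon.2 j).1),
      lt_of_le_of_ne (hx j).2 (hcon.2 j).2⟩
  refine (measure_mono hsub).trans ((measure_union_le _ _).trans ?_)
  rw [measure_iUnion_null fun j => measure_union_null (hμ (volume_hyperplane j _))
    (hμ (volume_hyperplane j _)), add_zero]

theorem basicCell_subset_unitCube (i : Idx d n) : basicCell i ⊆ unitCube d := by
  intro x hx j
  have hn : (0 : ℝ) < n := by exact_mod_cast (i j).pos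
  refine ⟨le_trans (by positivity) (hx j).1, (hx j).2.trans ?_⟩
  rw [div_le_one hn]
  exact_mod_cast (i j).isLt

theorem le_basicMass {μ : Measure (E d)} [IsProbabilityMeasure μ] (hμ : μ ≪ volume) {M : ℝ}
    (hM : 0 < M) (hlow : ∀ᵐ x ∂(volume.restrict (unitCube d)), M ≤ density μ x) (i : Idx d n) :
    M / (n : ℝ) ^ d ≤ (basicMass μ i).toReal := by
  have h1 : ENNReal.ofReal M * volume (basicCell i) ≤ μ (basicCell i) := by
    rw [← Measure.setLIntegral_rnDeriv hμ, ← setLIntegral_const]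
    refine lintegral_mono_ae ?_
    filter_upwards [ae_restrict_of_ae_restrict_of_subset (basicCell_subset_unitCube i) hlow]
      with x hx
    exact (ENNReal.ofReal_le_ofReal hx).trans ENNReal.ofReal_toReal_le
  have h2 : volume (basicCell i) = ENNReal.ofReal (1 / (n : ℝ) ^ d) := by
    rw [show basicCell i = {x : E d | ∀ j, ((i j : ℕ) : ℝ) / n ≤ x j ∧
      x j ≤ (((i j : ℕ) : ℝ) + 1) / n} from rfl, volume_box,
      ← ENNReal.ofReal_prod_of_nonneg]
    · congr 1
      simp [← sub_div]
    · intro j _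
      rw [← sub_div, add_sub_cancel_left]
      positivity
  rw [h2, ← ENNReal.ofReal_mul hM.le, mul_one_div] at h1
  exact (ENNReal.ofReal_le_iff_le_toReal (measure_ne_top _ _)).1 h1

end Mass

/-! ### Hausdorff measure of a box in a hyperplane -/

section Area

/-- The embedding of `ℝ^m` into `ℝ^(m+1)` as the hyperplane `x_j = t`. -/
def insertCoord {m : ℕ} (j : Fin (m + 1)) (t : ℝ) (y : E m) : E (m + 1) :=
  WithLp.toLp 2 (Fin.insertNth (α := fun _ => ℝ) j t (fun l => y l))

theorem isometry_insertCoord {m : ℕ} (j : Fin (m + 1)) (t : ℝ) : Isometry (insertCoord j t) := by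
  refine Isometry.of_dist_eq fun x y => ?_
  rw [EuclideanSpace.dist_eq, EuclideanSpace.dist_eq, Fin.sum_univ_succAbove _ j]
  simp [insertCoord]

/-- The set lies in the isometric image of a box in `ℝ^{d-1}`, where the measure is Lebesgue
measure. Degenerate sides are allowed and give measure zero. -/
theorem hausdorffMeasure_face_le {d : ℕ} (hd : 1 ≤ d) (j : Fin d) (t : ℝ) (a b : Fin d → ℝ) :
    (Measure.euclideanHausdorffMeasure (d - 1) : Measure (E d))
      {x | x j = t ∧ ∀ l, l ≠ j → a l ≤ x l ∧ x l ≤ b l} ≤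
      ∏ l ∈ Finset.univ.erase j, ENNReal.ofReal (b l - a l) := by
  obtain ⟨m, rfl⟩ : ∃ m, d = m + 1 := ⟨d - 1, by omega⟩
  have hset : {x : E (m + 1) | x j = t ∧ ∀ l, l ≠ j → a l ≤ x l ∧ x l ≤ b l} ⊆
      insertCoord j t '' {y : E m | ∀ l, a (j.succAbove l) ≤ y l ∧ y l ≤ b (j.succAbove l)} := by
    rintro x ⟨hx, hx'⟩
    refine ⟨WithLp.toLp 2 fun l => x (j.succAbove l),
      fun l => hx' _ (Fin.succAbove_ne j l), ?_⟩
    ext l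
    rcases Fin.eq_self_or_eq_succAbove j l with rfl | ⟨l, rfl⟩ <;> simp [insertCoord, hx]
  refine (measure_mono hset).trans ?_
  rw [(isometry_insertCoord j t).euclideanHausdorffMeasure_image, Nat.add_sub_cancel,
    EuclideanSpace.euclideanHausdorffMeasure_eq_volume, volume_box]
  have : Finset.univ.erase j = Finset.univ.map j.succAboveEmb := by
    ext l
    rcases Fin.eq_self_or_eq_succAbove j l with rfl | ⟨l, rfl⟩ <;> simp
  rw [this, Finset.prod_map]
  rfl

end Area

/-! ### Composite cells as products of blocks, and the areas of their interfaces -/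

section Blocks

variable {d n : ℕ}

/-- The partner of `a` in its one-dimensional block `{a' | ⌊(a'+s)/2⌋ = ⌊(a+s)/2⌋}`; it is `a`
itself if the block is a singleton. -/
def partner (s : ℕ) (a : Fin n) : Fin n :=
  if (a + s) % 2 = 0 then if h : (a : ℕ) + 1 < n then ⟨a + 1, h⟩ else a
  else ⟨a - 1, by omega⟩

theorem partner_cases (s : ℕ) (a : Fin n) :
    ((a + s) % 2 = 0 ∧ (a : ℕ) + 1 < n ∧ (partner s a : ℕ) = a + 1) ∨
    ((a + s) % 2 = 0 ∧ (a : ℕ) + 1 = n ∧ partner s a = a) ∨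
    ((a + s) % 2 = 1 ∧ 1 ≤ (a : ℕ) ∧ (partner s a : ℕ) = a - 1) ∨
    ((a + s) % 2 = 1 ∧ (a : ℕ) = 0 ∧ partner s a = a) := by
  have := a.isLt
  unfold partner
  split_ifs with h1 h2
  · exact Or.inl ⟨h1, h2, rfl⟩
  · exact Or.inr (Or.inl ⟨h1, by omega, rfl⟩)
  · rcases Nat.eq_zero_or_pos (a : ℕ) with h | h
    · refine Or.inr (Or.inr (Or.inr ⟨by omega, h, ?_⟩))
      ext; simp [h]
    · exact Or.inr (Or.inr (Or.inl ⟨by omega, h, rfl⟩))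

theorem partner_partner (s : ℕ) (a : Fin n) : partner s (partner s a) = a := by
  rcases partner_cases s a with ⟨h1, h2, h3⟩ | ⟨-, -, h3⟩ | ⟨h1, h2, h3⟩ | ⟨-, -, h3⟩
  · ext
    rcases partner_cases s (partner s a) with h | h | h | h <;> omega
  · rw [h3, h3]
  · ext
    rcases partner_cases s (partner s a) with h | h | h | h <;> omega
  · rw [h3, h3]

/-- A one-dimensional block is `{a, partner s a}`; this reduces membership in a composite cell to
flips of coordinates. -/
theorem half_eq_iff (s : ℕ) (a a' : Fin n) :
    ((a' : ℕ) + s) / 2 = (a + s) / 2 ↔ a' = a ∨ a' = partner s a := by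
  have := a.isLt
  have := a'.isLt
  simp only [Fin.ext_iff]
  rcases partner_cases s a with ⟨h1, h2, h3⟩ | ⟨h1, h2, h3⟩ | ⟨h1, h2, h3⟩ | ⟨h1, h2, h3⟩ <;>
    (try rw [h3]) <;> omega

/-- The number of basic cells of a composite cell in a coordinate direction. -/
def width (s : ℕ) (a : Fin n) : ℕ := if partner s a = a then 1 else 2

theorem width_pos (s : ℕ) (a : Fin n) : 0 < width s a := by unfold width; split_ifs <;> omega

theorem card_block (s : ℕ) (i : Idx d n) : (block s i).card = ∏ l, width s (i l) := by
  have : block s i = Fintype.piFinset fun l => {i l, partner s (i l)} := by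
    ext i'
    simp [mem_block, half_eq_iff s]
  rw [this, Fintype.card_piFinset]
  refine Finset.prod_congr rfl fun l _ => ?_
  unfold width
  split_ifs with h
  · simp [h]
  · rw [Finset.card_pair (Ne.symm h)]

/-- The lower end of the block of `a`. -/
def lowEnd (s : ℕ) (a : Fin n) : ℕ := min a (partner s a)

theorem lowEnd_le {s : ℕ} {a a' : Fin n} (h : ((a' : ℕ) + s) / 2 = (a + s) / 2) :
    lowEnd s a ≤ a' ∧ (a' : ℕ) + 1 ≤ lowEnd s a + width s a := by
  unfold lowEnd width
  have h' := (half_eq_iff s a a').1 h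
  rcases partner_cases s a with ⟨h1, h2, h3⟩ | ⟨h1, h2, h3⟩ | ⟨h1, h2, h3⟩ | ⟨h1, h2, h3⟩ <;>
    simp only [Fin.ext_iff, h3] at h' ⊢ <;> split_ifs <;> omega

theorem mem_cellRegion_block {s : ℕ} {i : Idx d n} {x : E d}
    (hx : x ∈ cellRegion (block s i)) (l : Fin d) :
    (lowEnd s (i l) : ℝ) / n ≤ x l ∧ x l ≤ ((lowEnd s (i l) : ℝ) + width s (i l)) / n := by
  simp only [cellRegion, mem_iUnion] at hx
  obtain ⟨i', hi', hx'⟩ := hx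
  obtain ⟨h1, h2⟩ := lowEnd_le (mem_block.1 hi' l)
  refine ⟨le_trans ?_ (hx' l).1, (hx' l).2.trans ?_⟩
  · gcongr
  · have : ((i' l : ℕ) : ℝ) + 1 ≤ (lowEnd s (i l) : ℝ) + width s (i l) := by exact_mod_cast h2
    gcongr

theorem lowEnd_add_width_le {s : ℕ} {a a' : Fin n}
    (h : ((a : ℕ) + s) / 2 < (a' + s) / 2) : lowEnd s a + width s a ≤ lowEnd s a' := by
  have := a.isLt
  have := a'.isLt
  unfold lowEnd width
  rcases partner_cases s a with ⟨h1, h2, h3⟩ | ⟨h1, h2, h3⟩ | ⟨h1, h2, h3⟩ | ⟨h1, h2, h3⟩ <;>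
  rcases partner_cases s a' with ⟨k1, k2, k3⟩ | ⟨k1, k2, k3⟩ | ⟨k1, k2, k3⟩ | ⟨k1, k2, k3⟩ <;>
    simp only [Fin.ext_iff, h3, k3] <;> split_ifs <;> omega

/-- Composite cells which differ in the coordinate `l` meet in a hyperplane only. -/
theorem exists_hyperplane {s : ℕ} {i i' : Idx d n} {l : Fin d}
    (h : ((i l : ℕ) + s) / 2 ≠ (i' l + s) / 2) :
    ∃ t : ℝ, ∀ x ∈ cellRegion (block s i) ∩ cellRegion (block s i'), x l = t := by
  rcases lt_or_gt_of_ne h with h | h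
  · refine ⟨((lowEnd s (i l) : ℝ) + width s (i l)) / n, fun x hx =>
      le_antisymm (mem_cellRegion_block hx.1 l).2
        (le_trans ?_ (mem_cellRegion_block hx.2 l).1)⟩
    have : ((lowEnd s (i l) : ℝ) + width s (i l)) ≤ lowEnd s (i' l) := by
      exact_mod_cast lowEnd_add_width_le h
    gcongr
  · refine ⟨((lowEnd s (i' l) : ℝ) + width s (i' l)) / n, fun x hx =>
      le_antisymm (mem_cellRegion_block hx.2 l).2
        (le_trans ?_ (mem_cellRegion_block hx.1 l).1)⟩
    have : ((lowEnd s (i' l) : ℝ) + width s (i' l)) ≤ lowEnd s (i l) := by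
      exact_mod_cast lowEnd_add_width_le h
    gcongr

theorem interfaceArea_comm (J J' : Finset (Idx d n)) : interfaceArea J J' = interfaceArea J' J := by
  rw [interfaceArea, interfaceArea, inter_comm]

theorem interfaceArea_le {s : ℕ} (hd : 1 ≤ d) {i i' : Idx d n} {j : Fin d}
    (h : ((i j : ℕ) + s) / 2 ≠ (i' j + s) / 2) :
    interfaceArea (block s i) (block s i') ≤
      ENNReal.ofReal ((∏ l ∈ Finset.univ.erase j, (width s (i l) : ℝ)) / (n : ℝ) ^ (d - 1)) := by
  obtain ⟨t, ht⟩ := exists_hyperplane h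
  refine (measure_mono (t := {x : E d | x j = t ∧ ∀ l, l ≠ j →
    (lowEnd s (i l) : ℝ) / n ≤ x l ∧ x l ≤ ((lowEnd s (i l) : ℝ) + width s (i l)) / n})
    fun x hx => ⟨ht x hx, fun l _ => mem_cellRegion_block hx.1 l⟩).trans ?_
  refine (hausdorffMeasure_face_le hd j t _ _).trans (le_of_eq ?_)
  rw [← ENNReal.ofReal_prod_of_nonneg]
  · congr 1
    simp [← sub_div, Finset.prod_div_distrib, Finset.card_erase_of_mem]
  · intro l _
    rw [← sub_div, add_sub_cancel_left]
    positivity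

/-- The intersection lies in two distinct coordinate hyperplanes: inside the first, it is a box
whose side in direction `l` has length zero. -/
theorem interfaceArea_eq_zero {s : ℕ} (hd : 1 ≤ d) {i i' : Idx d n} {j l : Fin d}
    (hjl : l ≠ j) (hj : ((i j : ℕ) + s) / 2 ≠ (i' j + s) / 2)
    (hl : ((i l : ℕ) + s) / 2 ≠ (i' l + s) / 2) :
    interfaceArea (block s i) (block s i') = 0 := by
  obtain ⟨t, ht⟩ := exists_hyperplane hj
  obtain ⟨r, hr⟩ := exists_hyperplane hl
  refine le_antisymm ((measure_mono (t := {x : E d | x j = t ∧ ∀ m, m ≠ j →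
    (fun m => if m = l then r else (lowEnd s (i m) : ℝ) / n) m ≤ x m ∧ x m ≤
      (fun m => if m = l then r else ((lowEnd s (i m) : ℝ) + width s (i m)) / n) m})
    fun x hx => ⟨ht x hx, fun m _ => ?_⟩).trans ?_) zero_le
  · by_cases hm : m = l
    · subst hm; simp [hr x hx]
    · simpa [hm] using mem_cellRegion_block hx.1 m
  · refine (hausdorffMeasure_face_le hd j t _ _).trans (le_of_eq ?_)
    exact Finset.prod_eq_zero (Finset.mem_erase.2 ⟨hjl, Finset.mem_univ l⟩) (by simp)

/-- A block lies strictly between the two in direction `j`, and it has positive width, so the closed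
regions are disjoint. -/
theorem interfaceArea_eq_zero_of_gap {s : ℕ} {i i' : Idx d n} {j : Fin d}
    (h : ((i j : ℕ) + s) / 2 + 1 < (i' j + s) / 2) :
    interfaceArea (block s i) (block s i') = 0 := by
  have : cellRegion (block s i) ∩ cellRegion (block s i') = ∅ := by
    refine eq_empty_iff_forall_notMem.2 fun x hx => ?_
    have h1 := (mem_cellRegion_block hx.1 j).2
    have h2 := (mem_cellRegion_block hx.2 j).1
    have hlt : lowEnd s (i j) + width s (i j) < lowEnd s (i' j) := by
      have hi := (i j).isLt
      have hi' := (i' j).isLt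
      unfold lowEnd width
      rcases partner_cases s (i j) with ⟨h1, h2, h3⟩ | ⟨h1, h2, h3⟩ | ⟨h1, h2, h3⟩ | ⟨h1, h2, h3⟩ <;>
      rcases partner_cases s (i' j) with ⟨k1, k2, k3⟩ | ⟨k1, k2, k3⟩ | ⟨k1, k2, k3⟩ | ⟨k1, k2, k3⟩ <;>
        simp only [Fin.ext_iff, h3, k3] <;> split_ifs <;> omega
    have hn : (0 : ℝ) < n := by exact_mod_cast (i j).pos
    have hlt' : ((lowEnd s (i j) : ℝ) + width s (i j)) < lowEnd s (i' j) := by exact_mod_cast hlt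
    have := (div_lt_div_iff_of_pos_right hn).2 hlt'
    linarith
  rw [interfaceArea, this, measure_empty]

end Blocks

/-! ### One-dimensional smooth profiles and hats -/

section Profile

/-- A `C¹` function with values in `[0,1]` which vanishes outside `[η, 1-η]`. -/
structure IsProfile (η : ℝ) (θ : ℝ → ℝ) : Prop where
  pos : 0 < η
  contDiff : ContDiff ℝ 1 θ
  nonneg : ∀ t, 0 ≤ θ t
  le_one : ∀ t, θ t ≤ 1
  mem_of_ne_zero : ∀ t, θ t ≠ 0 → η ≤ t ∧ t ≤ 1 - η

/-- Bumps centred at `1/2` whose inner and outer radii tend to `1/2`. The shift by `5` keeps the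
inner radius `1/2 - 2/(N+5)` positive from `N = 0` on. -/
theorem exists_profile_seq : ∃ θ : ℕ → ℝ → ℝ, (∀ N, ∃ η, IsProfile η (θ N)) ∧
    ∀ t, 0 < t → t < 1 → ∀ᶠ N in Filter.atTop, θ N t = 1 := by
  have hpos : ∀ N : ℕ, (0 : ℝ) < 1 / ((N : ℝ) + 5) := fun N => by positivity
  have hle : ∀ N : ℕ, 1 / ((N : ℝ) + 5) ≤ 1 / 5 := fun N => by
    gcongr; linarith [Nat.cast_nonneg (α := ℝ) N]
  let B : ∀ N : ℕ, ContDiffBump (1 / 2 : ℝ) := fun N =>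
    { rIn := 1 / 2 - 2 * (1 / ((N : ℝ) + 5))
      rOut := 1 / 2 - 1 / ((N : ℝ) + 5)
      rIn_pos := by linarith [hle N]
      rIn_lt_rOut := by linarith [hpos N] }
  refine ⟨fun N => B N, fun N => ⟨1 / ((N : ℝ) + 5), hpos N, (B N).contDiff,
    fun t => (B N).nonneg, fun t => (B N).le_one, fun t ht => ?_⟩, fun t h0 h1 => ?_⟩
  · have h : t ∈ Function.support (B N) := ht
    rw [(B N).support_eq, Metric.mem_ball, Real.dist_eq, abs_lt] at h
    have hr : (B N).rOut = 1 / 2 - 1 / ((N : ℝ) + 5) := rfl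
    rw [hr] at h
    constructor <;> linarith [h.1, h.2]
  · have hlim : Filter.Tendsto (fun N : ℕ => 2 * (1 / ((N : ℝ) + 5))) Filter.atTop (nhds (2 * 0)) :=
      (tendsto_const_nhds.div_atTop (Filter.tendsto_atTop_add_const_right _ _
        tendsto_natCast_atTop_atTop)).const_mul 2
    have hm : 2 * 0 < min t (1 - t) := by rw [mul_zero]; exact lt_min h0 (by linarith)
    filter_upwards [hlim.eventually_lt_const hm] with N hN
    refine (B N).one_of_mem_closedBall ?_
    have hr : (B N).rIn = 1 / 2 - 2 * (1 / ((N : ℝ) + 5)) := rfl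
    rw [Metric.mem_closedBall, Real.dist_eq, hr, abs_le]
    have := hN.trans_le (min_le_left _ _)
    have := hN.trans_le (min_le_right _ _)
    constructor <;> linarith

/-- The hat `t ↦ ∫_{t-1}^t θ`, whose derivative is `θ t - θ (t - 1)`. -/
noncomputable def hat (θ : ℝ → ℝ) (t : ℝ) : ℝ :=
  (∫ r in (0 : ℝ)..t, θ r) - ∫ r in (0 : ℝ)..(t - 1), θ r

variable {η : ℝ} {θ : ℝ → ℝ}

theorem IsProfile.hasDerivAt_hat (h : IsProfile η θ) (t : ℝ) :
    HasDerivAt (hat θ) (θ t - θ (t - 1)) t := by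
  have hF : ∀ r : ℝ, HasDerivAt (fun t => ∫ r in (0 : ℝ)..t, θ r) (θ r) r := fun r =>
    (h.contDiff.continuous).integral_hasStrictDerivAt 0 r |>.hasDerivAt
  have h1 : HasDerivAt (fun t => ∫ r in (0 : ℝ)..(t - 1), θ r) (θ (t - 1)) t :=
    HasDerivAt.comp_sub_const t 1 (hF (t - 1))
  exact (hF t).sub h1

theorem IsProfile.contDiff_hat (h : IsProfile η θ) : ContDiff ℝ 1 (hat θ) := by
  rw [contDiff_one_iff_deriv]
  refine ⟨fun t => (h.hasDerivAt_hat t).differentiableAt, ?_⟩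
  rw [funext fun t => (h.hasDerivAt_hat t).deriv]
  have := h.contDiff.continuous
  fun_prop

theorem IsProfile.hat_eq (h : IsProfile η θ) (t : ℝ) : hat θ t = ∫ r in (t - 1)..t, θ r :=
  intervalIntegral.integral_interval_sub_left (h.contDiff.continuous.intervalIntegrable _ _)
    (h.contDiff.continuous.intervalIntegrable _ _)

theorem IsProfile.hat_nonneg (h : IsProfile η θ) (t : ℝ) : 0 ≤ hat θ t := by
  rw [h.hat_eq]
  exact intervalIntegral.integral_nonneg (by linarith) fun r _ => h.nonneg r

theorem IsProfile.hat_le_one (h : IsProfile η θ) (t : ℝ) : hat θ t ≤ 1 := by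
  rw [h.hat_eq]
  calc _ ≤ ∫ _ in (t - 1)..t, (1 : ℝ) := intervalIntegral.integral_mono_on (by linarith)
        (h.contDiff.continuous.intervalIntegrable _ _) (by simp) fun r _ => h.le_one r
    _ = 1 := by simp

theorem IsProfile.mem_of_hat_ne_zero (h : IsProfile η θ) {t : ℝ} (ht : hat θ t ≠ 0) :
    η ≤ t ∧ t ≤ 2 - η := by
  by_contra hcon
  apply ht
  rw [h.hat_eq, intervalIntegral.integral_congr (g := fun _ => 0)]
  · simp
  · intro r hr
    rw [uIcc_of_le (by linarith)] at hr
    by_contra hne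
    have := h.mem_of_ne_zero r hne
    exact hcon ⟨this.1.trans hr.2, by linarith [this.2, hr.1]⟩

end Profile

/-! ### Test fields: neighbouring mass differences bounded by the total variation -/

section TestField

variable {d n : ℕ} {η : ℝ} {θ : ℝ → ℝ}

/-- The product of the profiles over the coordinates of a basic cell. -/
def cellProfile (θ : ℝ → ℝ) (i : Idx d n) (x : E d) : ℝ := ∏ l, θ ((n : ℝ) * x l - (i l : ℕ))

/-- The hat on the basic cells `i` and `i + e_j`. -/
noncomputable def hatProfile (θ : ℝ → ℝ) (j : Fin d) (i : Idx d n) (x : E d) : ℝ :=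
  hat θ ((n : ℝ) * x j - (i j : ℕ)) * ∏ l ∈ Finset.univ.erase j, θ ((n : ℝ) * x l - (i l : ℕ))

theorem contDiff_coord (l : Fin d) (a b : ℝ) : ContDiff ℝ 1 fun x : E d => a * x l - b :=
  (contDiff_const.mul (EuclideanSpace.proj (𝕜 := ℝ) l).contDiff).sub contDiff_const

theorem IsProfile.contDiff_hatProfile (h : IsProfile η θ) (j : Fin d) (i : Idx d n) :
    ContDiff ℝ 1 (hatProfile θ j i) :=
  (h.contDiff_hat.comp (contDiff_coord j _ _)).mul
    (contDiff_prod fun l _ => h.contDiff.comp (contDiff_coord l _ _))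

theorem IsProfile.abs_hatProfile_le (h : IsProfile η θ) (j : Fin d) (i : Idx d n) (x : E d) :
    |hatProfile θ j i x| ≤ 1 := by
  rw [hatProfile, abs_mul, Finset.abs_prod, abs_of_nonneg (h.hat_nonneg _)]
  refine mul_le_one₀ (h.hat_le_one _) (Finset.prod_nonneg fun _ _ => abs_nonneg _)
    (Finset.prod_le_one (fun _ _ => abs_nonneg _) fun l _ => ?_)
  rw [abs_of_nonneg (h.nonneg _)]
  exact h.le_one _

/-- Along the line `x + t e_j` only the hat factor varies. Its derivative is `θ` minus `θ` shifted
by one cell, and the scaling of the coordinate gives the factor `n`. -/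
theorem IsProfile.fderiv_hatProfile (h : IsProfile η θ) (s : ℕ) (j : Fin d) {i : Idx d n}
    (hi : (partner s (i j) : ℕ) = i j + 1) (x : E d) :
    fderiv ℝ (hatProfile θ j i) x (EuclideanSpace.single j 1) =
      n * (cellProfile θ i x - cellProfile θ (Function.update i j (partner s (i j))) x) := by
  have h1 : HasDerivAt (fun t : ℝ => hatProfile θ j i (x + t • EuclideanSpace.single j (1 : ℝ)))
      (fderiv ℝ (hatProfile θ j i) x (EuclideanSpace.single j 1)) 0 := by
    have hf := ((h.contDiff_hatProfile j i).differentiable (by norm_num) x).hasFDerivAt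
    have hl : HasDerivAt (fun t : ℝ => x + t • (EuclideanSpace.single j (1 : ℝ) : E d))
        (EuclideanSpace.single j (1 : ℝ)) 0 := by
      simpa using ((hasDerivAt_id (0 : ℝ)).smul_const
        (EuclideanSpace.single j (1 : ℝ) : E d)).const_add x
    exact HasFDerivAt.comp_hasDerivAt (x := (0 : ℝ)) (by simpa using hf) hl
  have h2 : HasDerivAt (fun t : ℝ => hatProfile θ j i (x + t • EuclideanSpace.single j (1 : ℝ)))
      ((θ ((n : ℝ) * x j - (i j : ℕ)) - θ ((n : ℝ) * x j - (i j : ℕ) - 1)) * n *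
        ∏ l ∈ Finset.univ.erase j, θ ((n : ℝ) * x l - (i l : ℕ))) 0 := by
    have heq : (fun t : ℝ => hatProfile θ j i (x + t • EuclideanSpace.single j (1 : ℝ))) =
        fun t => hat θ ((n : ℝ) * (x j + t) - (i j : ℕ)) *
          ∏ l ∈ Finset.univ.erase j, θ ((n : ℝ) * x l - (i l : ℕ)) := by
      funext t
      unfold hatProfile
      congr 1
      · simp
      · refine Finset.prod_congr rfl fun l hl => ?_
        simp [Finset.ne_of_mem_erase hl]
    rw [heq]
    refine HasDerivAt.mul_const ?_ _
    have hin : HasDerivAt (fun t : ℝ => (n : ℝ) * (x j + t) - (i j : ℕ)) n 0 := by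
      simpa using (((hasDerivAt_id (0 : ℝ)).const_add (x j)).const_mul (n : ℝ)).sub_const
        ((i j : ℕ) : ℝ)
    have ho := h.hasDerivAt_hat ((n : ℝ) * (x j + 0) - (i j : ℕ))
    rw [add_zero] at ho
    exact HasDerivAt.comp (0 : ℝ) (by simpa using ho) hin
  rw [h1.unique h2]
  have e1 : cellProfile θ i x = θ ((n : ℝ) * x j - (i j : ℕ)) *
      ∏ l ∈ Finset.univ.erase j, θ ((n : ℝ) * x l - (i l : ℕ)) :=
    (Finset.mul_prod_erase _ _ (Finset.mem_univ j)).symm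
  have e2 : cellProfile θ (Function.update i j (partner s (i j))) x =
      θ ((n : ℝ) * x j - (i j : ℕ) - 1) *
      ∏ l ∈ Finset.univ.erase j, θ ((n : ℝ) * x l - (i l : ℕ)) := by
    rw [cellProfile, ← Finset.mul_prod_erase _ _ (Finset.mem_univ j)]
    congr 1
    · rw [Function.update_self, hi]
      push_cast
      ring_nf
    · refine Finset.prod_congr rfl fun l hl => ?_
      rw [Function.update_of_ne (Finset.ne_of_mem_erase hl)]
  rw [e1, e2]
  ring

/-- The basic cells whose partner in direction `j` is the next cell `i + e_j`. -/
def lowerCells (d n s : ℕ) (j : Fin d) : Finset (Idx d n) :=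
  Finset.univ.filter fun i => (partner s (i j) : ℕ) = i j + 1

theorem mem_lowerCells {s : ℕ} {j : Fin d} {i : Idx d n} :
    i ∈ lowerCells d n s j ↔ (partner s (i j) : ℕ) = i j + 1 := by
  simp [lowerCells]

theorem add_mod_two_of_partner {s : ℕ} {a : Fin n} (h : (partner s a : ℕ) = a + 1) :
    (a + s) % 2 = 0 := by
  rcases partner_cases s a with h' | h' | h' | h'
  · exact h'.1
  · exact h'.1
  · omega
  · rw [h'.2.2] at h; omega

theorem IsProfile.hatProfile_mem (h : IsProfile η θ) {j : Fin d} {i : Idx d n} {x : E d}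
    (hx : hatProfile θ j i x ≠ 0) :
    (η ≤ (n : ℝ) * x j - (i j : ℕ) ∧ (n : ℝ) * x j - (i j : ℕ) ≤ 2 - η) ∧
    ∀ l, l ≠ j → η ≤ (n : ℝ) * x l - (i l : ℕ) ∧ (n : ℝ) * x l - (i l : ℕ) ≤ 1 - η := by
  obtain ⟨h1, h2⟩ := mul_ne_zero_iff.1 hx
  refine ⟨h.mem_of_hat_ne_zero h1, fun l hl => h.mem_of_ne_zero _ ?_⟩
  exact Finset.prod_ne_zero_iff.1 h2 l (Finset.mem_erase.2 ⟨hl, Finset.mem_univ l⟩)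

/-- The `j`-th indices of lower cells all have the parity of `s`. A hat covers less than two cells
in direction `j` and less than one in the others, so distinct hats have disjoint supports. -/
theorem IsProfile.hatProfile_unique (h : IsProfile η θ) {s : ℕ} {j : Fin d} {i i' : Idx d n}
    (hi : i ∈ lowerCells d n s j) (hi' : i' ∈ lowerCells d n s j) {x : E d}
    (hx : hatProfile θ j i x ≠ 0) (hx' : hatProfile θ j i' x ≠ 0) : i = i' := by
  rw [mem_lowerCells] at hi hi'
  obtain ⟨h1, h2⟩ := h.hatProfile_mem hx
  obtain ⟨h1', h2'⟩ := h.hatProfile_mem hx'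
  have hη := h.pos
  funext l
  ext
  by_cases hl : l = j
  · subst hl
    have k1 : ((i l : ℕ) : ℝ) < (i' l : ℕ) + 2 := by linarith [h1.1, h1'.2]
    have k2 : ((i' l : ℕ) : ℝ) < (i l : ℕ) + 2 := by linarith [h1.2, h1'.1]
    have k1' : (i l : ℕ) < (i' l : ℕ) + 2 := by exact_mod_cast k1
    have k2' : (i' l : ℕ) < (i l : ℕ) + 2 := by exact_mod_cast k2
    have := add_mod_two_of_partner hi
    have := add_mod_two_of_partner hi'
    omega
  · have k1 : ((i l : ℕ) : ℝ) < (i' l : ℕ) + 1 := by linarith [(h2 l hl).1, (h2' l hl).2]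
    have k2 : ((i' l : ℕ) : ℝ) < (i l : ℕ) + 1 := by linarith [(h2 l hl).2, (h2' l hl).1]
    have k1' : (i l : ℕ) < (i' l : ℕ) + 1 := by exact_mod_cast k1
    have k2' : (i' l : ℕ) < (i l : ℕ) + 1 := by exact_mod_cast k2
    omega

/-- The closed cube of the points at distance at least `r` from the boundary of the unit cube. -/
def innerCube (d : ℕ) (r : ℝ) : Set (E d) := {x | ∀ l, r ≤ x l ∧ x l ≤ 1 - r}

theorem isClosed_innerCube (d : ℕ) (r : ℝ) : IsClosed (innerCube d r) := by
  have : innerCube d r = ⋂ j, {x : E d | r ≤ x j} ∩ {x | x j ≤ 1 - r} := by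
    ext x; simp [innerCube]
  rw [this]
  exact isClosed_iInter fun j =>
    (isClosed_le continuous_const (by fun_prop)).inter (isClosed_le (by fun_prop) continuous_const)

theorem isCompact_innerCube (d : ℕ) {r : ℝ} (hr : 0 < r) : IsCompact (innerCube d r) := by
  refine Metric.isCompact_of_isClosed_isBounded (isClosed_innerCube d r)
    ((Metric.isBounded_closedBall (x := (0 : E d)) (r := √d)).subset fun x hx => ?_)
  rw [mem_closedBall_zero_iff, EuclideanSpace.norm_eq]
  refine Real.sqrt_le_sqrt ?_
  calc ∑ l, ‖x l‖ ^ 2 ≤ ∑ _l : Fin d, (1 : ℝ) := Finset.sum_le_sum fun l _ => by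
        rw [Real.norm_eq_abs, sq_abs]
        have := hx l
        nlinarith
    _ = d := by simp

theorem innerCube_subset_interior (d : ℕ) {r : ℝ} (hr : 0 < r) :
    innerCube d r ⊆ interior (unitCube d) := by
  have hopen : IsOpen {x : E d | ∀ j, 0 < x j ∧ x j < 1} := by
    have : {x : E d | ∀ j, 0 < x j ∧ x j < 1} = ⋂ j, {x : E d | 0 < x j} ∩ {x | x j < 1} := by
      ext x; simp
    rw [this]
    exact isOpen_iInter_of_finite fun j =>
      (isOpen_lt continuous_const (by fun_prop)).inter (isOpen_lt (by fun_prop) continuous_const)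
  have hsub : {x : E d | ∀ j, 0 < x j ∧ x j < 1} ⊆ unitCube d :=
    fun x hx j => ⟨(hx j).1.le, (hx j).2.le⟩
  intro x hx
  refine interior_maximal hsub hopen fun j => ?_
  have := hx j
  constructor <;> linarith

theorem IsProfile.mem_innerCube (h : IsProfile η θ) {s : ℕ} {j : Fin d} {i : Idx d n}
    (hi : i ∈ lowerCells d n s j) {x : E d} (hx : hatProfile θ j i x ≠ 0) :
    x ∈ innerCube d (η / n) := by
  obtain ⟨h1, h2⟩ := h.hatProfile_mem hx
  intro l
  have hn : (0 : ℝ) < n := by exact_mod_cast (i l).pos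
  have h0 : (0 : ℝ) ≤ (i l : ℕ) := Nat.cast_nonneg _
  have key : η ≤ (n : ℝ) * x l ∧ (n : ℝ) * x l ≤ n - η := by
    by_cases hl : l = j
    · subst hl
      -- The partner `i + e_j` is again a basic cell, so a hat two cells long still stays away from
      -- the boundary of the cube.
      have := (partner s (i l)).isLt
      rw [mem_lowerCells.1 hi] at this
      have : ((i l : ℕ) : ℝ) + 2 ≤ n := by exact_mod_cast this
      constructor <;> linarith [h1.1, h1.2]
    · have : ((i l : ℕ) : ℝ) + 1 ≤ n := by exact_mod_cast (i l).isLt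
      constructor <;> linarith [(h2 l hl).1, (h2 l hl).2]
  constructor
  · rw [div_le_iff₀ hn]; linarith [key.1]
  · rw [le_sub_iff_add_le, ← le_sub_iff_add_le', div_le_iff₀ hn]; linarith [key.2]

/-- The test field for the differences of the masses in direction `j`. -/
noncomputable def testField (θ : ℝ → ℝ) (s : ℕ) (j : Fin d) (ψ : Idx d n → ℝ) (x : E d) : E d :=
  (∑ i ∈ lowerCells d n s j, ψ i * hatProfile θ j i x) • EuclideanSpace.single j 1

theorem IsProfile.contDiff_sum (h : IsProfile η θ) (s : ℕ) (j : Fin d) (ψ : Idx d n → ℝ) :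
    ContDiff ℝ 1 fun x => ∑ i ∈ lowerCells d n s j, ψ i * hatProfile θ j i x :=
  ContDiff.sum fun i _ => contDiff_const.mul (h.contDiff_hatProfile j i)

theorem IsProfile.divergence_testField (h : IsProfile η θ) (s : ℕ) (j : Fin d)
    (ψ : Idx d n → ℝ) (x : E d) :
    divergence (testField θ s j ψ) x = ∑ i ∈ lowerCells d n s j, n * ψ i *
      (cellProfile θ i x - cellProfile θ (Function.update i j (partner s (i j))) x) := by
  have hd := (h.contDiff_sum s j ψ).differentiable (by norm_num) x
  have h1 : ∀ v, fderiv ℝ (testField θ s j ψ) x v =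
      (fderiv ℝ (fun x => ∑ i ∈ lowerCells d n s j, ψ i * hatProfile θ j i x) x v) •
        (EuclideanSpace.single j (1 : ℝ) : E d) := fun v => by
    have := (hd.hasFDerivAt.smul_const (EuclideanSpace.single j (1 : ℝ) : E d)).fderiv
    unfold testField
    rw [this]
    rfl
  unfold divergence
  rw [Finset.sum_eq_single j]
  · rw [h1, fderiv_fun_sum fun i _ => ((h.contDiff_hatProfile j i).differentiable (by norm_num)
      x).const_mul _]
    simp only [sum_apply, PiLp.smul_apply, PiLp.single_apply, if_true,
      smul_eq_mul, mul_one]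
    refine Finset.sum_congr rfl fun i hi => ?_
    rw [fderiv_const_mul ((h.contDiff_hatProfile j i).differentiable (by norm_num) x)]
    rw [smul_apply, h.fderiv_hatProfile s j (mem_lowerCells.1 hi), smul_eq_mul]
    ring
  · intro l _ hl
    rw [h1]
    simp [hl]
  · simp

/-- At each point at most one hat is nonzero, so the bound by one survives the summation. The
support lies in a compact inner cube, so the field is admissible for the open cube as well as for
the whole space. -/
theorem IsProfile.testField_mem (h : IsProfile η θ) (s : ℕ) (j : Fin d) (hn : 0 < n)
    {ψ : Idx d n → ℝ} (hψ : ∀ i, |ψ i| ≤ 1) {Ω : Set (E d)} (hΩ : interior (unitCube d) ⊆ Ω) :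
    testField θ s j ψ ∈ {φ : E d → E d | ContDiff ℝ 1 φ ∧ HasCompactSupport φ ∧
      tsupport φ ⊆ Ω ∧ ∀ x, ‖φ x‖ ≤ 1} := by
  have hn' : (0 : ℝ) < n := by exact_mod_cast hn
  have hr : 0 < η / n := div_pos h.pos hn'
  have hsupp : Function.support (testField θ s j ψ) ⊆ innerCube d (η / n) := by
    intro x hx
    by_contra hcon
    refine hx ?_
    unfold testField
    rw [Finset.sum_eq_zero, zero_smul]
    intro i hi
    rw [mul_eq_zero]
    right
    by_contra hne
    exact hcon (h.mem_innerCube hi hne)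
  have hts : tsupport (testField θ s j ψ) ⊆ innerCube d (η / n) :=
    closure_minimal hsupp (isClosed_innerCube d _)
  refine ⟨(h.contDiff_sum s j ψ).smul contDiff_const,
    (isCompact_innerCube d hr).of_isClosed_subset (isClosed_tsupport _) hts,
    hts.trans ((innerCube_subset_interior d hr).trans hΩ), fun x => ?_⟩
  unfold testField
  rw [norm_smul, PiLp.norm_single, norm_one, mul_one, Real.norm_eq_abs]
  by_cases hex : ∃ i ∈ lowerCells d n s j, hatProfile θ j i x ≠ 0
  · obtain ⟨i, hi, hne⟩ := hex
    rw [Finset.sum_eq_single_of_mem i hi, abs_mul]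
    · exact mul_le_one₀ (hψ i) (abs_nonneg _) (h.abs_hatProfile_le j i x)
    · intro i' hi' hii
      rw [mul_eq_zero]
      right
      by_contra hne'
      exact hii (h.hatProfile_unique hi' hi hne' hne)
  · push Not at hex
    rw [Finset.sum_eq_zero fun i hi => by rw [hex i hi, mul_zero], abs_zero]
    exact zero_le_one

theorem IsProfile.cellProfile_nonneg (h : IsProfile η θ) (i : Idx d n) (x : E d) :
    0 ≤ cellProfile θ i x := Finset.prod_nonneg fun _ _ => h.nonneg _

theorem IsProfile.cellProfile_le_one (h : IsProfile η θ) (i : Idx d n) (x : E d) :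
    cellProfile θ i x ≤ 1 := Finset.prod_le_one (fun _ _ => h.nonneg _) fun _ _ => h.le_one _

theorem IsProfile.continuous_cellProfile (h : IsProfile η θ) (i : Idx d n) :
    Continuous (cellProfile θ i) :=
  continuous_finsetProd _ fun l _ => h.contDiff.continuous.comp (contDiff_coord l _ _).continuous

theorem IsProfile.integrable_cellProfile (h : IsProfile η θ) (i : Idx d n) (μ : Measure (E d))
    [IsFiniteMeasure μ] : Integrable (cellProfile θ i) μ :=
  Integrable.of_bound (h.continuous_cellProfile i).aestronglyMeasurable 1
    (Filter.Eventually.of_forall fun x => by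
      rw [Real.norm_eq_abs, abs_of_nonneg (h.cellProfile_nonneg i x)]
      exact h.cellProfile_le_one i x)

/-- Dominated convergence to the indicator of the open cell. Absolute continuity makes its mass
equal to that of the closed cell. -/
theorem tendsto_integral_cellProfile {μ : Measure (E d)} [IsProbabilityMeasure μ]
    (hμ : μ ≪ volume) {θ : ℕ → ℝ → ℝ} (hθ : ∀ N, ∃ η, IsProfile η (θ N))
    (hlim : ∀ t, 0 < t → t < 1 → ∀ᶠ N in Filter.atTop, θ N t = 1) (i : Idx d n) :
    Filter.Tendsto (fun N => ∫ x, cellProfile (θ N) i x ∂μ) Filter.atTop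
      (nhds (basicMass μ i).toReal) := by
  have hmeas : MeasurableSet (openCell i) := by
    have : openCell i = ⋂ j, {x : E d | ((i j : ℕ) : ℝ) / n < x j} ∩
        {x | x j < (((i j : ℕ) : ℝ) + 1) / n} := by
      ext x; simp [openCell]
    rw [this]
    exact (isOpen_iInter_of_finite fun j => (isOpen_lt continuous_const (by fun_prop)).inter
      (isOpen_lt (by fun_prop) continuous_const)).measurableSet
  have hI : (basicMass μ i).toReal = ∫ x, (openCell i).indicator (fun _ => (1 : ℝ)) x ∂μ := by
    rw [integral_indicator_const _ hmeas, Measure.real, measure_openCell hμ]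
    simp
  rw [hI]
  refine tendsto_integral_of_dominated_convergence (fun _ => (1 : ℝ))
    (fun N => ?_) (integrable_const _) (fun N => Filter.Eventually.of_forall fun x => ?_)
    (Filter.Eventually.of_forall fun x => ?_)
  · obtain ⟨η, h⟩ := hθ N
    exact (h.continuous_cellProfile i).aestronglyMeasurable
  · obtain ⟨η, h⟩ := hθ N
    rw [Real.norm_eq_abs, abs_of_nonneg (h.cellProfile_nonneg i x)]
    exact h.cellProfile_le_one i x
  · by_cases hx : x ∈ openCell i
    · rw [indicator_of_mem hx]
      refine tendsto_const_nhds.congr' ?_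
      have : ∀ l, ∀ᶠ N in Filter.atTop, θ N ((n : ℝ) * x l - (i l : ℕ)) = 1 := fun l => by
        have hn : (0 : ℝ) < n := by exact_mod_cast (i l).pos
        have h1 := (div_lt_iff₀ hn).1 (hx l).1
        have h2 := (lt_div_iff₀ hn).1 (hx l).2
        exact hlim _ (by linarith) (by linarith)
      filter_upwards [Filter.eventually_all.2 this] with N hN
      exact (Finset.prod_eq_one fun l _ => hN l).symm
    · rw [indicator_of_notMem hx]
      refine tendsto_const_nhds.congr fun N => ?_
      obtain ⟨η, h⟩ := hθ N
      by_contra hne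
      refine hx fun l => ?_
      have hn : (0 : ℝ) < n := by exact_mod_cast (i l).pos
      have := h.mem_of_ne_zero _ (Finset.prod_ne_zero_iff.1 (Ne.symm hne) l (Finset.mem_univ l))
      have hη := h.pos
      constructor
      · rw [div_lt_iff₀ hn]; linarith [this.1]
      · rw [lt_div_iff₀ hn]; linarith [this.2]

/-- The differences of the masses of the pairs of partners in direction `j` are controlled by the
total variation of the density. -/
theorem sum_lowerCells_le {μ : Measure (E d)} [IsProbabilityMeasure μ] (hμ : μ ≪ volume)
    {Ω : Set (E d)} (hΩ : interior (unitCube d) ⊆ Ω) (hBV : totalVariation Ω (density μ) ≠ ∞)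
    (hn : 0 < n) (s : ℕ) (j : Fin d) :
    n * ∑ i ∈ lowerCells d n s j, |(basicMass μ i).toReal -
      (basicMass μ (Function.update i j (partner s (i j)))).toReal| ≤
      (totalVariation Ω (density μ)).toReal := by
  obtain ⟨θ, hθ, hlim⟩ := exists_profile_seq
  set τ : Idx d n → Idx d n := fun i => Function.update i j (partner s (i j)) with hτ
  -- These signs turn the limit of the tested differences into a sum of absolute values.
  set ψ : Idx d n → ℝ := fun i =>
    SignType.sign ((basicMass μ i).toReal - (basicMass μ (τ i)).toReal) with hψdef
  have hψ : ∀ i, |ψ i| ≤ 1 := fun i => by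
    simp only [hψdef]
    rcases SignType.sign ((basicMass μ i).toReal - (basicMass μ (τ i)).toReal) with _ | _ | _ <;>
      simp
  have hN : ∀ N, ∑ i ∈ lowerCells d n s j, n * ψ i * ((∫ x, cellProfile (θ N) i x ∂μ) -
      ∫ x, cellProfile (θ N) (τ i) x ∂μ) ≤ (totalVariation Ω (density μ)).toReal := by
    intro N
    obtain ⟨η, h⟩ := hθ N
    have h1 : ENNReal.ofReal (∫ x, density μ x * divergence (testField (θ N) s j ψ) x) ≤
        totalVariation Ω (density μ) :=
      le_iSup₂_of_le (f := fun (φ : E d → E d) (_ : φ ∈ {φ : E d → E d | ContDiff ℝ 1 φ ∧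
        HasCompactSupport φ ∧ tsupport φ ⊆ Ω ∧ ∀ x, ‖φ x‖ ≤ 1}) =>
        ENNReal.ofReal (∫ x, density μ x * divergence φ x)) _
        (h.testField_mem s j hn hψ hΩ) le_rfl
    have h2 := (ENNReal.ofReal_le_iff_le_toReal hBV).1 h1
    refine le_trans (le_of_eq ?_) h2
    -- Integration of the density against Lebesgue measure becomes integration against `μ`.
    have h3 := integral_rnDeriv_smul hμ (f := divergence (testField (θ N) s j ψ))
    simp only [smul_eq_mul] at h3
    unfold density
    rw [h3, funext fun x => h.divergence_testField s j ψ x, integral_finsetSum]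
    · refine Finset.sum_congr rfl fun i _ => ?_
      rw [integral_const_mul, integral_sub (h.integrable_cellProfile i μ)
        (h.integrable_cellProfile _ μ)]
    · exact fun i _ => ((h.integrable_cellProfile i μ).sub
        (h.integrable_cellProfile _ μ)).const_mul _
  have hT := le_of_tendsto' (tendsto_finsetSum (lowerCells d n s j) fun i _ =>
    ((tendsto_integral_cellProfile hμ hθ hlim i).sub
      (tendsto_integral_cellProfile hμ hθ hlim (τ i))).const_mul (n * ψ i)) hN
  refine le_trans (le_of_eq ?_) hT
  rw [Finset.mul_sum]
  refine Finset.sum_congr rfl fun i _ => ?_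
  rw [mul_assoc, hψdef, sign_mul_self]

end TestField

/-! ### Deviation of the masses from their means over composite cells -/

section Average

variable {d n : ℕ}

/-- Replace the coordinates in `S` by their partners. -/
def flip (s : ℕ) (S : Finset (Fin d)) (i : Idx d n) : Idx d n :=
  fun l => if l ∈ S then partner s (i l) else i l

theorem flip_flip (s : ℕ) (S T : Finset (Fin d)) (i : Idx d n) :
    flip s S (flip s T i) = flip s (symmDiff S T) i := by
  funext l
  by_cases hS : l ∈ S <;> by_cases hT : l ∈ T <;>
    simp [flip, hS, hT, Finset.mem_symmDiff, partner_partner]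

theorem flip_empty (s : ℕ) (i : Idx d n) : flip s ∅ i = i := by
  funext l; simp [flip]

theorem flip_singleton (s : ℕ) (j : Fin d) (i : Idx d n) :
    flip s {j} i = Function.update i j (partner s (i j)) := by
  funext l
  by_cases h : l = j
  · subst h; simp [flip]
  · simp [flip, h]

theorem flip_involutive (s : ℕ) (S : Finset (Fin d)) :
    Function.Involutive (flip s S : Idx d n → Idx d n) := fun i => by
  rw [flip_flip, symmDiff_self]; exact flip_empty s i

theorem sum_flip (s : ℕ) (S : Finset (Fin d)) (f : Idx d n → ℝ) :
    ∑ i, f (flip s S i) = ∑ i, f i :=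
  Equiv.sum_comp (flip_involutive s S).toPerm f

theorem exists_flip_of_mem_block {s : ℕ} {i i' : Idx d n} (h : i' ∈ block s i) :
    ∃ S, i' = flip s S i := by
  refine ⟨Finset.univ.filter fun l => i' l ≠ i l, funext fun l => ?_⟩
  simp only [flip, Finset.mem_filter, Finset.mem_univ, true_and]
  split_ifs with h'
  · exact ((half_eq_iff s (i l) (i' l)).1 (mem_block.1 h l)).resolve_left h'
  · exact not_not.1 h'

/-- The average of `m` over all flips; it is constant on the composite cells. -/
noncomputable def flipMean (s : ℕ) (m : Idx d n → ℝ) (i : Idx d n) : ℝ :=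
  (2 ^ d)⁻¹ * ∑ S : Finset (Fin d), m (flip s S i)

/-- Flips compose by symmetric difference, so moving within the block only permutes the summands. -/
theorem flipMean_eq_of_mem {s : ℕ} (m : Idx d n → ℝ) {i i' : Idx d n} (h : i' ∈ block s i) :
    flipMean s m i' = flipMean s m i := by
  obtain ⟨T, rfl⟩ := exists_flip_of_mem_block h
  simp only [flipMean, flip_flip]
  congr 1
  exact Equiv.sum_comp (Function.Involutive.toPerm (fun S => symmDiff S T)
    fun S => symmDiff_symmDiff_cancel_right T S) fun S => m (flip s S i)

/-- Flip one coordinate at a time and use the triangle inequality. Each partial flip is a bijection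
of the index set, so it can be removed from the sum over `i`. -/
theorem sum_abs_sub_flip_le (s : ℕ) (m : Idx d n → ℝ) (S : Finset (Fin d)) :
    ∑ i, |m i - m (flip s S i)| ≤ ∑ j ∈ S, ∑ i, |m i - m (flip s {j} i)| := by
  induction S using Finset.induction_on with
  | empty => simp [flip_empty]
  | insert a S ha ih =>
    rw [Finset.sum_insert ha]
    have hf : ∀ i : Idx d n, flip s (insert a S) i = flip s {a} (flip s S i) := fun i => by
      rw [flip_flip]
      congr 1
      ext l
      by_cases hl : l = a
      · subst hl; simp [Finset.mem_symmDiff, ha]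
      · simp [Finset.mem_symmDiff, hl]
    rw [← sum_flip s S fun i => |m i - m (flip s {a} i)|]
    refine le_trans ?_ (add_le_add le_rfl ih)
    rw [← Finset.sum_add_distrib]
    refine Finset.sum_le_sum fun i _ => ?_
    rw [hf, add_comm]
    exact abs_sub_le _ _ _

theorem card_filter_mem (j : Fin d) :
    2 * ((Finset.univ.filter fun S : Finset (Fin d) => j ∈ S).card : ℝ) = 2 ^ d := by
  have h1 : (Finset.univ.filter fun S : Finset (Fin d) => j ∈ S).card =
      (Finset.univ.filter fun S : Finset (Fin d) => ¬ j ∈ S).card :=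
    Finset.card_bij' (fun S _ => symmDiff S {j}) (fun S _ => symmDiff S {j})
      (by simp [Finset.mem_symmDiff]) (by simp [Finset.mem_symmDiff])
      (fun S _ => symmDiff_symmDiff_cancel_right _ S)
      (fun S _ => symmDiff_symmDiff_cancel_right _ S)
  have h2 := Finset.card_filter_add_card_filter_not (s := Finset.univ)
    (fun S : Finset (Fin d) => j ∈ S)
  rw [← h1, Finset.card_univ, Fintype.card_finset, Fintype.card_fin] at h2
  rw [two_mul]
  exact_mod_cast h2

theorem sum_abs_sub_flipMean_le (s : ℕ) (m : Idx d n → ℝ) :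
    ∑ i, |m i - flipMean s m i| ≤ 2⁻¹ * ∑ j, ∑ i, |m i - m (flip s {j} i)| := by
  have h2 : (0 : ℝ) < 2 ^ d := by positivity
  have hcard : ((Finset.univ : Finset (Finset (Fin d))).card : ℝ) = 2 ^ d := by
    simp [Fintype.card_finset]
  have h1 : ∀ i : Idx d n, |m i - flipMean s m i| ≤
      (2 ^ d)⁻¹ * ∑ S : Finset (Fin d), |m i - m (flip s S i)| := fun i => by
    have : m i - flipMean s m i = (2 ^ d)⁻¹ * ∑ S : Finset (Fin d), (m i - m (flip s S i)) := by
      rw [Finset.sum_sub_distrib, Finset.sum_const, nsmul_eq_mul, hcard, mul_sub,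
        inv_mul_cancel_left₀ h2.ne', flipMean]
    rw [this, abs_mul, abs_of_pos (inv_pos.2 h2)]
    gcongr
    exact Finset.abs_sum_le_sum_abs _ _
  calc ∑ i, |m i - flipMean s m i|
      ≤ ∑ i, (2 ^ d)⁻¹ * ∑ S : Finset (Fin d), |m i - m (flip s S i)| :=
        Finset.sum_le_sum fun i _ => h1 i
    _ = (2 ^ d)⁻¹ * ∑ S : Finset (Fin d), ∑ i, |m i - m (flip s S i)| := by
        rw [← Finset.mul_sum, Finset.sum_comm]
    _ ≤ (2 ^ d)⁻¹ * ∑ S : Finset (Fin d), ∑ j ∈ S, ∑ i, |m i - m (flip s {j} i)| := by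
        gcongr with S
        exact sum_abs_sub_flip_le s m S
    -- Each `j` belongs to exactly half of the `2^d` subsets; this is the origin of the factor
    -- `1/2`.
    _ = (2 ^ d)⁻¹ * ∑ j, (2⁻¹ * 2 ^ d) * ∑ i, |m i - m (flip s {j} i)| := by
        congr 1
        rw [Finset.sum_comm' (t' := Finset.univ)
          (s' := fun j => Finset.univ.filter fun S : Finset (Fin d) => j ∈ S) (by simp)]
        refine Finset.sum_congr rfl fun j _ => ?_
        rw [Finset.sum_const, nsmul_eq_mul, ← card_filter_mem j, inv_mul_cancel_left₀ two_ne_zero]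
    _ = _ := by
        rw [← Finset.mul_sum, ← mul_assoc]
        congr 1
        field_simp

/-- For any constant `c`, the mean over `J` differs from `c` by at most the average of `|m i - c|`.
Replacing `c` by the mean therefore at most doubles the total deviation; here `c` is the flip mean.
-/
theorem sum_abs_sub_block_mean_le {s : ℕ} {J : Finset (Idx d n)}
    (hJ : J ∈ shiftedPartition d n s) (m : Idx d n → ℝ) :
    ∑ i ∈ J, |(J.card : ℝ)⁻¹ * ∑ i' ∈ J, m i' - m i| ≤
      2 * ∑ i ∈ J, |m i - flipMean s m i| := by
  obtain ⟨i₀, rfl⟩ := mem_shiftedPartition.1 hJ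
  set J := block s i₀
  set c := flipMean s m i₀ with hc
  have hcard : (0 : ℝ) < J.card := by
    exact_mod_cast Finset.card_pos.2 ⟨i₀, self_mem_block s i₀⟩
  have hcJ : ∀ i ∈ J, flipMean s m i = c := fun i hi => flipMean_eq_of_mem m hi
  have hR : ∑ i ∈ J, |m i - flipMean s m i| = ∑ i ∈ J, |m i - c| :=
    Finset.sum_congr rfl fun i hi => by rw [hcJ i hi]
  rw [hR]
  set a := (J.card : ℝ)⁻¹ * ∑ i' ∈ J, m i' with ha
  have hsum : J.card * (a - c) = ∑ i ∈ J, (m i - c) := by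
    rw [Finset.sum_sub_distrib, Finset.sum_const, nsmul_eq_mul, mul_sub, ha,
      mul_inv_cancel_left₀ hcard.ne']
  have h1 : J.card * |a - c| ≤ ∑ i ∈ J, |m i - c| := by
    rw [← Nat.abs_cast J.card, ← abs_mul, hsum]
    exact Finset.abs_sum_le_sum_abs _ _
  calc ∑ i ∈ J, |a - m i| ≤ ∑ i ∈ J, (|a - c| + |m i - c|) := by
        refine Finset.sum_le_sum fun i _ => (abs_sub_le a c (m i)).trans ?_
        rw [abs_sub_comm c]
    _ = J.card * |a - c| + ∑ i ∈ J, |m i - c| := by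
        rw [Finset.sum_add_distrib, Finset.sum_const, nsmul_eq_mul]
    _ ≤ _ := by linarith

/-- Each pair of partners in direction `j` has exactly one lower cell. -/
theorem sum_abs_sub_flip_singleton_le (s : ℕ) (m : Idx d n → ℝ) (j : Fin d) :
    ∑ i, |m i - m (flip s {j} i)| ≤
      2 * ∑ i ∈ lowerCells d n s j, |m i - m (Function.update i j (partner s (i j)))| := by
  set F : Idx d n → ℝ := fun i => if i ∈ lowerCells d n s j then |m i - m (flip s {j} i)| else 0
    with hF
  have hF0 : ∀ i, 0 ≤ F i := fun i => by simp only [hF]; split_ifs <;> positivity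
  have hpt : ∀ i, |m i - m (flip s {j} i)| ≤ F i + F (flip s {j} i) := by
    intro i
    by_cases hi : i ∈ lowerCells d n s j
    · have : F i = |m i - m (flip s {j} i)| := if_pos hi
      linarith [hF0 (flip s {j} i)]
    have hval : flip s {j} i j = partner s (i j) := by simp [flip]
    rcases partner_cases s (i j) with h | h | h | h
    · exact absurd (mem_lowerCells.2 h.2.2) hi
    · have : flip s {j} i = i := by rw [flip_singleton, h.2.2, Function.update_eq_self]
      rw [this, sub_self, abs_zero]
      linarith [hF0 i]
    · have hmem : flip s {j} i ∈ lowerCells d n s j := by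
        rw [mem_lowerCells, hval, partner_partner]
        omega
      have : F (flip s {j} i) = |m (flip s {j} i) - m (flip s {j} (flip s {j} i))| := if_pos hmem
      rw [flip_involutive s {j} i, abs_sub_comm] at this
      linarith [hF0 i]
    · have : flip s {j} i = i := by rw [flip_singleton, h.2.2, Function.update_eq_self]
      rw [this, sub_self, abs_zero]
      linarith [hF0 i]
  calc _ ≤ ∑ i, (F i + F (flip s {j} i)) := Finset.sum_le_sum fun i _ => hpt i
    _ = 2 * ∑ i, F i := by rw [Finset.sum_add_distrib, sum_flip s {j} F, two_mul]
    _ = _ := by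
      simp only [hF, Finset.sum_ite_mem, Finset.univ_inter, flip_singleton]

/-- The deviation of the masses from their means over the composite cells. -/
theorem sum_mass_deviation_le {μ : Measure (E d)} [IsProbabilityMeasure μ] (hμ : μ ≪ volume)
    {Ω : Set (E d)} (hΩ : interior (unitCube d) ⊆ Ω) (hBV : totalVariation Ω (density μ) ≠ ∞)
    (hn : 0 < n) (s : ℕ) :
    n * ∑ J ∈ shiftedPartition d n s, ∑ i ∈ J, |(J.card : ℝ)⁻¹ *
      ∑ i' ∈ J, (basicMass μ i').toReal - (basicMass μ i).toReal| ≤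
      2 * d * (totalVariation Ω (density μ)).toReal := by
  set m : Idx d n → ℝ := fun i => (basicMass μ i).toReal
  have h1 : ∑ J ∈ shiftedPartition d n s, ∑ i ∈ J, |(J.card : ℝ)⁻¹ * ∑ i' ∈ J, m i' - m i| ≤
      2 * ∑ i, |m i - flipMean s m i| := by
    rw [← sum_shiftedPartition s fun i => |m i - flipMean s m i|, Finset.mul_sum]
    exact Finset.sum_le_sum fun J hJ => sum_abs_sub_block_mean_le hJ m
  have h2 := sum_abs_sub_flipMean_le s m
  have h3 : ∑ j, ∑ i, |m i - m (flip s {j} i)| ≤ ∑ j : Fin d,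
      2 * ∑ i ∈ lowerCells d n s j, |m i - m (Function.update i j (partner s (i j)))| :=
    Finset.sum_le_sum fun j _ => sum_abs_sub_flip_singleton_le s m j
  have h4 : ∑ j : Fin d, n * ∑ i ∈ lowerCells d n s j,
      |m i - m (Function.update i j (partner s (i j)))| ≤
      ∑ _j : Fin d, (totalVariation Ω (density μ)).toReal :=
    Finset.sum_le_sum fun j _ => sum_lowerCells_le hμ hΩ hBV hn s j
  rw [Finset.sum_const, Finset.card_univ, Fintype.card_fin, nsmul_eq_mul, ← Finset.mul_sum] at h4
  rw [← Finset.mul_sum] at h3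
  -- The `1/2` from the subsets cancels the `2` from counting both cells of a pair; the `2` from the
  -- block mean remains.
  have h5 : ∑ J ∈ shiftedPartition d n s, ∑ i ∈ J, |(J.card : ℝ)⁻¹ * ∑ i' ∈ J, m i' - m i| ≤
      2 * ∑ j : Fin d, ∑ i ∈ lowerCells d n s j,
      |m i - m (Function.update i j (partner s (i j)))| := by linarith
  have h6 := mul_le_mul_of_nonneg_left h5 (Nat.cast_nonneg (α := ℝ) n)
  linarith

end Average

/-! ### Neighbouring composite cells and the translation by two cells -/

section Neighbours

variable {d n : ℕ}

theorem width_eq_of_mem_block {s : ℕ} {i i' : Idx d n} (h : i' ∈ block s i) (l : Fin d) :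
    width s (i' l) = width s (i l) := by
  rcases (half_eq_iff s (i l) (i' l)).1 (mem_block.1 h l) with h | h
  · rw [h]
  · rw [h, width, width, partner_partner]
    simp only [eq_comm]

theorem width_eq_one_or_two (s : ℕ) (a : Fin n) : width s a = 1 ∨ width s a = 2 := by
  unfold width; split_ifs <;> simp

theorem eq_end_of_width_eq_one {s : ℕ} {a : Fin n} (h : width s a = 1) :
    (a : ℕ) = 0 ∨ (a : ℕ) = n - 1 := by
  have hp : partner s a = a := by
    by_contra hne
    simp [width, hne] at h
  have hp' := congrArg Fin.val hp
  rcases partner_cases s a with h | h | h | h <;> omega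

/-- `J` is the composite cell next to `J'` in direction `e_j`. -/
def IsNext (s : ℕ) (j : Fin d) (J J' : Finset (Idx d n)) : Prop :=
  ∃ i ∈ J, ∃ i' ∈ J', ((i j : ℕ) + s) / 2 = (i' j + s) / 2 + 1 ∧
    ∀ l, l ≠ j → ((i l : ℕ) + s) / 2 = (i' l + s) / 2

theorem isNext_block {s : ℕ} {j : Fin d} {i i' : Idx d n} :
    IsNext s j (block s i) (block s i') ↔ ((i j : ℕ) + s) / 2 = (i' j + s) / 2 + 1 ∧
    ∀ l, l ≠ j → ((i l : ℕ) + s) / 2 = (i' l + s) / 2 := by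
  constructor
  · rintro ⟨k, hk, k', hk', h1, h2⟩
    rw [mem_block] at hk hk'
    refine ⟨by rw [← hk, ← hk', h1], fun l hl => by rw [← hk, ← hk', h2 l hl]⟩
  · rintro ⟨h1, h2⟩
    exact ⟨i, self_mem_block s i, i', self_mem_block s i', h1, h2⟩

theorem block_eq_iff {s : ℕ} {i i' : Idx d n} :
    block s i = block s i' ↔ ∀ l, ((i l : ℕ) + s) / 2 = (i' l + s) / 2 := by
  constructor
  · intro h
    exact mem_block.1 (h ▸ self_mem_block s i)
  · intro h
    exact block_eq_of_mem (mem_block.2 h)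

theorem IsNext.unique_right {s : ℕ} {j : Fin d} {J J₁ J₂ : Finset (Idx d n)}
    (hJ : J ∈ shiftedPartition d n s) (hJ₁ : J₁ ∈ shiftedPartition d n s)
    (hJ₂ : J₂ ∈ shiftedPartition d n s) (h₁ : IsNext s j J J₁) (h₂ : IsNext s j J J₂) :
    J₁ = J₂ := by
  obtain ⟨i, rfl⟩ := mem_shiftedPartition.1 hJ
  obtain ⟨i₁, rfl⟩ := mem_shiftedPartition.1 hJ₁
  obtain ⟨i₂, rfl⟩ := mem_shiftedPartition.1 hJ₂
  rw [isNext_block] at h₁ h₂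
  refine block_eq_iff.2 fun l => ?_
  by_cases hl : l = j
  · subst hl; omega
  · rw [← h₁.2 l hl, ← h₂.2 l hl]

theorem IsNext.unique_left {s : ℕ} {j : Fin d} {J J₁ J₂ : Finset (Idx d n)}
    (hJ : J ∈ shiftedPartition d n s) (hJ₁ : J₁ ∈ shiftedPartition d n s)
    (hJ₂ : J₂ ∈ shiftedPartition d n s) (h₁ : IsNext s j J₁ J) (h₂ : IsNext s j J₂ J) :
    J₁ = J₂ := by
  obtain ⟨i, rfl⟩ := mem_shiftedPartition.1 hJ
  obtain ⟨i₁, rfl⟩ := mem_shiftedPartition.1 hJ₁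
  obtain ⟨i₂, rfl⟩ := mem_shiftedPartition.1 hJ₂
  rw [isNext_block] at h₁ h₂
  refine block_eq_iff.2 fun l => ?_
  by_cases hl : l = j
  · subst hl; omega
  · rw [h₁.2 l hl, h₂.2 l hl]

/-- Positive interface area excludes both a second differing block coordinate and a gap in the
first. -/
theorem Adjacent.exists_isNext {s : ℕ} (hd : 1 ≤ d) {J J' : Finset (Idx d n)}
    (hJ : J ∈ shiftedPartition d n s) (hJ' : J' ∈ shiftedPartition d n s) (h : Adjacent J J') :
    ∃ j, IsNext s j J J' ∨ IsNext s j J' J := by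
  obtain ⟨i, rfl⟩ := mem_shiftedPartition.1 hJ
  obtain ⟨i', rfl⟩ := mem_shiftedPartition.1 hJ'
  obtain ⟨hne, hpos⟩ := h
  rw [Ne, block_eq_iff] at hne
  push Not at hne
  obtain ⟨j, hj⟩ := hne
  have hother : ∀ l, l ≠ j → ((i l : ℕ) + s) / 2 = (i' l + s) / 2 := fun l hl => by
    by_contra hcon
    rw [interfaceArea_eq_zero hd hl hj hcon] at hpos
    exact lt_irrefl _ hpos
  have h1 : ¬ ((i j : ℕ) + s) / 2 + 1 < (i' j + s) / 2 := fun hlt => by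
    rw [interfaceArea_eq_zero_of_gap hlt] at hpos
    exact lt_irrefl _ hpos
  have h2 : ¬ ((i' j : ℕ) + s) / 2 + 1 < (i j + s) / 2 := fun hlt => by
    rw [interfaceArea_comm, interfaceArea_eq_zero_of_gap hlt] at hpos
    exact lt_irrefl _ hpos
  refine ⟨j, ?_⟩
  rw [isNext_block, isNext_block]
  rcases lt_or_gt_of_ne hj with hlt | hlt
  · exact Or.inr ⟨by omega, fun l hl => (hother l hl).symm⟩
  · exact Or.inl ⟨by omega, hother⟩

/-- The translation by `-2e_j` (truncated at the boundary). -/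
def shiftDown (j : Fin d) (i : Idx d n) : Idx d n :=
  Function.update i j ⟨(i j : ℕ) - 2, lt_of_le_of_lt (Nat.sub_le _ _) (i j).isLt⟩

/-- A full block of width two lies below, so the truncation in `shiftDown` never takes effect on
`block s i`. -/
theorem two_le_of_isNext {s : ℕ} {j : Fin d} {i i' : Idx d n}
    (h : IsNext s j (block s i) (block s i')) (hi' : width s (i' j) = 2) {k : Idx d n}
    (hk : k ∈ block s i) : 2 ≤ (k j : ℕ) := by
  have h1 := (isNext_block.1 h).1
  have h2 := mem_block.1 hk j
  have h3 : partner s (i' j) ≠ i' j := fun h => by simp [width, h] at hi'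
  rcases partner_cases s (i' j) with h | h | h | h
  · omega
  · exact absurd h.2.2 h3
  · omega
  · exact absurd h.2.2 h3

theorem injOn_shiftDown {s : ℕ} {j : Fin d} {i i' : Idx d n}
    (h : IsNext s j (block s i) (block s i')) (hi' : width s (i' j) = 2) :
    Set.InjOn (shiftDown j) (block s i : Set (Idx d n)) := by
  intro k hk k' hk' heq
  have h1 := two_le_of_isNext h hi' (Finset.mem_coe.1 hk)
  have h2 := two_le_of_isNext h hi' (Finset.mem_coe.1 hk')
  funext l
  have hl := congrFun heq l
  by_cases hlj : l = j
  · subst hlj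
    simp only [shiftDown, Function.update_self, Fin.mk.injEq] at hl
    ext
    omega
  · simpa [shiftDown, hlj] using hl

theorem image_shiftDown {s : ℕ} {j : Fin d} {i i' : Idx d n}
    (h : IsNext s j (block s i) (block s i')) (hi : width s (i j) = 2)
    (hi' : width s (i' j) = 2) : (block s i).image (shiftDown j) = block s i' := by
  obtain ⟨h1, h2⟩ := isNext_block.1 h
  ext k
  rw [Finset.mem_image]
  constructor
  · rintro ⟨k, hk, rfl⟩
    have hk2 := two_le_of_isNext h hi' hk
    rw [mem_block] at hk ⊢
    intro l
    by_cases hl : l = j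
    · subst hl
      have := hk l
      simp only [shiftDown, Function.update_self]
      omega
    · simp only [shiftDown, Function.update_of_ne hl]
      rw [hk l, h2 l hl]
  · intro hk
    rw [mem_block] at hk
    have hkj := hk j
    -- Surjectivity needs width two of the upper block as well: otherwise the translate by `+2e_j`
    -- could leave the grid.
    have hlt : (k j : ℕ) + 2 < n := by
      have h3 : partner s (i j) ≠ i j := fun h => by simp [width, h] at hi
      have := (i j).isLt
      rcases partner_cases s (i j) with h | h | h | h
      · omega
      · exact absurd h.2.2 h3
      · omega
      · exact absurd h.2.2 h3
    refine ⟨Function.update k j ⟨(k j : ℕ) + 2, hlt⟩, ?_, ?_⟩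
    · rw [mem_block]
      intro l
      by_cases hl : l = j
      · subst hl
        simp only [Function.update_self]
        omega
      · simp only [Function.update_of_ne hl]
        rw [hk l, h2 l hl]
    · funext l
      by_cases hl : l = j
      · subst hl; simp [shiftDown]
      · simp [shiftDown, hl]

theorem sub_shiftDown {j : Fin d} {i : Idx d n} (h : 2 ≤ (i j : ℕ)) :
    (fun l => ((i l : ℕ) : ℤ) - ((shiftDown j i l : ℕ) : ℤ)) = Pi.single j 2 := by
  funext l
  by_cases hl : l = j
  · subst hl
    simp only [shiftDown, Function.update_self, Pi.single_eq_same]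
    omega
  · simp [shiftDown, hl]

theorem card_block_eq_mul (s : ℕ) (i : Idx d n) (j : Fin d) :
    ((block s i).card : ℝ) = width s (i j) * ∏ l ∈ Finset.univ.erase j, (width s (i l) : ℝ) := by
  rw [card_block s i, Finset.mul_prod_erase Finset.univ (fun l => (width s (i l) : ℝ))
    (Finset.mem_univ j)]
  push_cast
  rfl

theorem IsNext.interfaceArea_le {s : ℕ} (hd : 1 ≤ d) {j : Fin d} {i i' : Idx d n}
    (h : IsNext s j (block s i) (block s i')) :
    interfaceArea (block s i) (block s i') ≤
      ENNReal.ofReal ((block s i).card / width s (i j) / (n : ℝ) ^ (d - 1)) := by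
  refine (DomDec.interfaceArea_le hd (j := j) ?_).trans (le_of_eq ?_)
  · have := (isNext_block.1 h).1
    omega
  · rw [card_block_eq_mul s i j, mul_div_cancel_left₀]
    exact_mod_cast (width_pos s (i j)).ne'

/-- The number of basic cells in the boundary layers orthogonal to `e_j`. -/
theorem card_width_eq_one_le (s : ℕ) (j : Fin d) :
    ((Finset.univ.filter fun i : Idx d n => width s (i j) = 1).card : ℝ) ≤
      2 * (n : ℝ) ^ (d - 1) := by
  have hcard : ∀ a : ℕ, (Finset.univ.filter fun i : Idx d n => (i j : ℕ) = a).card ≤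
      n ^ (d - 1) := by
    intro a
    have hsub : (Finset.univ.filter fun i : Idx d n => (i j : ℕ) = a) ⊆
        Fintype.piFinset fun l => if l = j then Finset.univ.filter fun b : Fin n => (b : ℕ) = a
          else Finset.univ := by
      intro i hi
      rw [Fintype.mem_piFinset]
      intro l
      split_ifs with hl
      · subst hl; simpa using hi
      · simp
    refine (Finset.card_le_card hsub).trans ?_
    rw [Fintype.card_piFinset, ← Finset.mul_prod_erase _ _ (Finset.mem_univ j), if_pos rfl]
    have h1 : (Finset.univ.filter fun b : Fin n => (b : ℕ) = a).card ≤ 1 :=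
      Finset.card_le_one.2 fun b hb b' hb' => by
        simp only [Finset.mem_filter, Finset.mem_univ, true_and] at hb hb'
        exact Fin.ext (hb.trans hb'.symm)
    have h2 : ∏ l ∈ Finset.univ.erase j, (if l = j then
        Finset.univ.filter fun b : Fin n => (b : ℕ) = a else Finset.univ).card = n ^ (d - 1) := by
      rw [Finset.prod_congr rfl fun l hl => by rw [if_neg (Finset.ne_of_mem_erase hl)]]
      simp [Finset.card_erase_of_mem]
    rw [h2]
    exact (Nat.mul_le_mul_right _ h1).trans (one_mul _).le
  have hsub : (Finset.univ.filter fun i : Idx d n => width s (i j) = 1) ⊆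
      (Finset.univ.filter fun i : Idx d n => (i j : ℕ) = 0) ∪
      (Finset.univ.filter fun i : Idx d n => (i j : ℕ) = n - 1) := by
    intro i hi
    simp only [Finset.mem_filter, Finset.mem_univ, true_and, Finset.mem_union] at hi ⊢
    exact eq_end_of_width_eq_one hi
  have h := (Finset.card_le_card hsub).trans (Finset.card_union_le _ _)
  have h' : (Finset.univ.filter fun i : Idx d n => width s (i j) = 1).card ≤ 2 * n ^ (d - 1) := by
    linarith [hcard 0, hcard (n - 1)]
  exact_mod_cast h'

end Neighbours

/-! ### Composite marginals as mixtures of basic marginals -/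

section Densities

variable {d n : ℕ} {Y : Type*} [MeasurableSpace Y] {μ : Measure (E d)} {π : Measure (E d × Y)}

theorem isProbabilityMeasure_basicRho [IsProbabilityMeasure μ] {i : Idx d n}
    (hm : 0 < (basicMass μ i).toReal)
    (hπ : partialMarginal π (basicCell i) univ = basicMass μ i) :
    IsProbabilityMeasure (basicRho μ π i) := by
  refine ⟨?_⟩
  rw [basicRho, Measure.smul_apply, hπ, smul_eq_mul, ENNReal.inv_mul_cancel]
  · intro h; simp [h] at hm
  · exact measure_ne_top _ _

/-- The weight of the basic cell `i` in the composite cell `J`. -/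
noncomputable def weight (μ : Measure (E d)) (J : Finset (Idx d n)) (i : Idx d n) : ℝ :=
  (basicMass μ i).toReal / ∑ i' ∈ J, (basicMass μ i').toReal

theorem weight_nonneg (J : Finset (Idx d n)) (i : Idx d n) : 0 ≤ weight μ J i :=
  div_nonneg ENNReal.toReal_nonneg (Finset.sum_nonneg fun _ _ => ENNReal.toReal_nonneg)

theorem sum_weight {J : Finset (Idx d n)} (hJ : J.Nonempty)
    (hm : ∀ i : Idx d n, 0 < (basicMass μ i).toReal) : ∑ i ∈ J, weight μ J i = 1 := by
  unfold weight
  rw [← Finset.sum_div, div_self]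
  exact (Finset.sum_pos (fun i _ => hm i) hJ).ne'

theorem compositeRho_eq [IsProbabilityMeasure μ] {J : Finset (Idx d n)} (hJ : J.Nonempty)
    (hm : ∀ i : Idx d n, 0 < (basicMass μ i).toReal) :
    compositeRho μ π J = ∑ i ∈ J, ENNReal.ofReal (weight μ J i) • basicRho μ π i := by
  have hpos := Finset.sum_pos (fun i (_ : i ∈ J) => hm i) hJ
  rw [compositeRho, Finset.smul_sum]
  refine Finset.sum_congr rfl fun i _ => ?_
  have h0 : basicMass μ i ≠ 0 := fun h => by simpa [h] using hm i
  have hC : ENNReal.ofReal (∑ i' ∈ J, (basicMass μ i').toReal) = compositeMass μ J := by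
    rw [ENNReal.ofReal_sum_of_nonneg fun _ _ => ENNReal.toReal_nonneg, compositeMass]
    exact Finset.sum_congr rfl fun i _ => ENNReal.ofReal_toReal (measure_ne_top _ _)
  rw [basicRho, smul_smul, weight, ENNReal.ofReal_div_of_pos hpos, hC,
    ENNReal.ofReal_toReal (a := basicMass μ i) (measure_ne_top μ _), div_eq_mul_inv, mul_comm (basicMass μ i), mul_assoc,
    ENNReal.mul_inv_cancel h0 (measure_ne_top _ _), mul_one]

theorem isProbabilityMeasure_compositeRho [IsProbabilityMeasure μ] {J : Finset (Idx d n)}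
    (hJ : J.Nonempty) (hm : ∀ i : Idx d n, 0 < (basicMass μ i).toReal)
    (hρ : ∀ i : Idx d n, IsProbabilityMeasure (basicRho μ π i)) :
    IsProbabilityMeasure (compositeRho μ π J) := by
  refine ⟨?_⟩
  rw [compositeRho_eq hJ hm, Measure.finsetSum_apply]
  simp only [Measure.smul_apply, measure_univ, smul_eq_mul, mul_one]
  rw [← ENNReal.ofReal_sum_of_nonneg fun i _ => weight_nonneg J i, sum_weight hJ hm,
    ENNReal.ofReal_one]

end Densities

/-! ### Transport cost across one interface -/

section PairEstimate

variable {d n : ℕ} {Y : Type*} [PseudoEMetricSpace Y] [MeasurableSpace Y]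
  {μ : Measure (E d)} {π : Measure (E d × Y)}

open Classical in
/-- The cost of the pair `i`, `i - 2e_j`. -/
noncomputable def skipCost (μ : Measure (E d)) (π : Measure (E d × Y)) (j : Fin d) (i : Idx d n) :
    ℝ≥0∞ :=
  ∑ i' : Idx d n, if (fun l => ((i l : ℕ) : ℤ) - ((i' l : ℕ) : ℤ)) = Pi.single j 2 then
    wasserstein (basicRho μ π i) (basicRho μ π i') else 0

theorem wasserstein_shiftDown_le {j : Fin d} {i : Idx d n} (h : 2 ≤ (i j : ℕ)) :
    wasserstein (basicRho μ π i) (basicRho μ π (shiftDown j i)) ≤ skipCost μ π j i := by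
  classical
  refine le_trans (le_of_eq ?_) (Finset.single_le_sum (fun _ _ => zero_le)
    (Finset.mem_univ (shiftDown j i)))
  rw [if_pos (sub_shiftDown h)]

/-- The error made in a composite cell when the masses of its basic cells are treated as equal,
or when the cell belongs to a boundary layer orthogonal to `e_j`. -/
noncomputable def cellError (D : ℝ) (μ : Measure (E d)) (s : ℕ) (j : Fin d)
    (J : Finset (Idx d n)) : ℝ :=
  D * (J.card / 2 / (n : ℝ) ^ (d - 1) * ∑ i ∈ J, |weight μ J i - (J.card : ℝ)⁻¹| +
    (J.filter fun i => width s (i j) = 1).card / (n : ℝ) ^ (d - 1))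

theorem cellError_nonneg {D : ℝ} (hD : 0 ≤ D) (s : ℕ) (j : Fin d) (J : Finset (Idx d n)) :
    0 ≤ cellError D μ s j J := by
  unfold cellError
  have : 0 ≤ ∑ i ∈ J, |weight μ J i - (J.card : ℝ)⁻¹| :=
    Finset.sum_nonneg fun _ _ => abs_nonneg _
  positivity

theorem le_cellError_of_width_eq_one {D : ℝ} (hD : 0 ≤ D) {s : ℕ} {j : Fin d} {i : Idx d n}
    (hi : width s (i j) = 1) :
    (block s i).card / width s (i j) / (n : ℝ) ^ (d - 1) * D ≤
      cellError D μ s j (block s i) := by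
  have hf : (block s i).filter (fun k => width s (k j) = 1) = block s i :=
    Finset.filter_true_of_mem fun k hk => (width_eq_of_mem_block hk j).trans hi
  have : 0 ≤ ∑ k ∈ block s i, |weight μ (block s i) k - ((block s i).card : ℝ)⁻¹| :=
    Finset.sum_nonneg fun _ _ => abs_nonneg _
  rw [cellError, hf, hi, Nat.cast_one, div_one, mul_comm]
  refine mul_le_mul_of_nonneg_left (le_add_of_nonneg_left ?_) hD
  positivity

/-- If one of the cells has width one in direction `j`, the diameter bound is charged to that cell.
Otherwise the mixtures are compared along the translation by `2e_j`. -/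
theorem IsNext.cost_le [IsProbabilityMeasure μ] (hd : 1 ≤ d)
    {D : ℝ} (hD0 : 0 ≤ D) (hD : ∀ x y : Y, edist x y ≤ ENNReal.ofReal D)
    (hm : ∀ i : Idx d n, 0 < (basicMass μ i).toReal)
    (hρ : ∀ i : Idx d n, IsProbabilityMeasure (basicRho μ π i)) {s : ℕ} {j : Fin d}
    {J J' : Finset (Idx d n)} (hJ : J ∈ shiftedPartition d n s)
    (hJ' : J' ∈ shiftedPartition d n s) (h : IsNext s j J J') :
    interfaceArea J J' * wasserstein (compositeRho μ π J) (compositeRho μ π J') ≤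
      2⁻¹ * ((n : ℝ≥0∞) ^ (d - 1))⁻¹ * ∑ i ∈ J, skipCost μ π j i +
        ENNReal.ofReal (cellError D μ s j J) + ENNReal.ofReal (cellError D μ s j J') := by
  obtain ⟨i, rfl⟩ := mem_shiftedPartition.1 hJ
  obtain ⟨i', rfl⟩ := mem_shiftedPartition.1 hJ'
  have hne : (block s i).Nonempty := ⟨i, self_mem_block s i⟩
  have hne' : (block s i').Nonempty := ⟨i', self_mem_block s i'⟩
  have hn : (0 : ℝ) < n := by exact_mod_cast (i j).pos
  have hp : (0 : ℝ) < (n : ℝ) ^ (d - 1) := by positivity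
  have := isProbabilityMeasure_compositeRho hne hm hρ
  have := isProbabilityMeasure_compositeRho hne' hm hρ
  have hW : wasserstein (compositeRho μ π (block s i)) (compositeRho μ π (block s i')) ≤
      ENNReal.ofReal D := by
    refine (wasserstein_le_diam_mul hD (by simp)).trans ?_
    rw [measure_univ, mul_one]
  have hA := h.interfaceArea_le hd
  rcases width_eq_one_or_two s (i j) with hi | hi
  · calc _ ≤ ENNReal.ofReal ((block s i).card / width s (i j) / (n : ℝ) ^ (d - 1)) *
          ENNReal.ofReal D := mul_le_mul' hA hW
      _ ≤ ENNReal.ofReal (cellError D μ s j (block s i)) := by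
        rw [← ENNReal.ofReal_mul (by positivity)]
        exact ENNReal.ofReal_le_ofReal (le_cellError_of_width_eq_one hD0 hi)
      _ ≤ _ := le_add_right le_add_self
  rcases width_eq_one_or_two s (i' j) with hi' | hi'
  · have hA' : interfaceArea (block s i) (block s i') ≤
        ENNReal.ofReal ((block s i').card / width s (i' j) / (n : ℝ) ^ (d - 1)) := by
      rw [interfaceArea_comm]
      refine (DomDec.interfaceArea_le hd (j := j) ?_).trans (le_of_eq ?_)
      · have := (isNext_block.1 h).1
        omega
      · rw [card_block_eq_mul s i' j, mul_div_cancel_left₀]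
        exact_mod_cast (width_pos s (i' j)).ne'
    calc _ ≤ ENNReal.ofReal ((block s i').card / width s (i' j) / (n : ℝ) ^ (d - 1)) *
          ENNReal.ofReal D := mul_le_mul' hA' hW
      _ ≤ ENNReal.ofReal (cellError D μ s j (block s i')) := by
        rw [← ENNReal.ofReal_mul (by positivity)]
        exact ENNReal.ofReal_le_ofReal (le_cellError_of_width_eq_one hD0 hi')
      _ ≤ _ := le_add_self
  have hinj := injOn_shiftDown h hi'
  have himg := image_shiftDown h hi hi'
  have hcard : (block s i').card = (block s i).card := by
    rw [← himg, Finset.card_image_of_injOn hinj]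
  have hsum : ∀ {M : Type} [AddCommMonoid M] (f : Idx d n → M),
      ∑ k ∈ block s i', f k = ∑ k ∈ block s i, f (shiftDown j k) := fun f => by
    rw [← himg, Finset.sum_image hinj]
  have hc0 : (0 : ℝ) < (block s i).card := by exact_mod_cast hne.card_pos
  -- Both mixtures are indexed by `block s i` and compared with the uniform weight `1/|J|`.
  have hmix := wasserstein_mixture_le hD0 hD (block s i) (weight μ (block s i))
    (fun k => weight μ (block s i') (shiftDown j k)) ((block s i).card : ℝ)⁻¹ (by positivity)
    (fun k _ => weight_nonneg _ k) (fun k _ => weight_nonneg _ _) (sum_weight hne hm)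
    (by rw [← hsum (weight μ (block s i')), sum_weight hne' hm])
    (by rw [Finset.sum_const, nsmul_eq_mul, mul_inv_cancel₀ hc0.ne'])
    (basicRho μ π) (fun k => basicRho μ π (shiftDown j k)) (fun k _ => hρ k) (fun k _ => hρ _)
  have hsumY : ∑ k ∈ block s i, ENNReal.ofReal (weight μ (block s i') (shiftDown j k)) •
      basicRho μ π (shiftDown j k) = compositeRho μ π (block s i') := by
    rw [compositeRho_eq hne' hm, ← himg, Finset.sum_image hinj]
  rw [← compositeRho_eq hne hm, hsumY] at hmix
  have hskip : ∑ k ∈ block s i, wasserstein (basicRho μ π k) (basicRho μ π (shiftDown j k)) ≤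
      ∑ k ∈ block s i, skipCost μ π j k :=
    Finset.sum_le_sum fun k hk => wasserstein_shiftDown_le (two_le_of_isNext h hi' hk)
  rw [hi] at hA
  push_cast at hA
  refine (mul_le_mul' hA hmix).trans ?_
  rw [mul_add, add_assoc, ← mul_assoc, ← ENNReal.ofReal_mul (by positivity),
    ← ENNReal.ofReal_mul (by positivity), ← ENNReal.ofReal_add (cellError_nonneg hD0 _ _ _)
      (cellError_nonneg hD0 _ _ _)]
  refine add_le_add (mul_le_mul' (le_of_eq ?_) hskip) (ENNReal.ofReal_le_ofReal ?_)
  -- The area bound `|J|/(2n^{d-1})` times the uniform weight no longer depends on `|J|`.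
  · rw [show ((block s i).card : ℝ) / 2 / (n : ℝ) ^ (d - 1) * ((block s i).card : ℝ)⁻¹ =
      (2 : ℝ)⁻¹ * ((n : ℝ) ^ (d - 1))⁻¹ by field_simp, ENNReal.ofReal_mul (by positivity),
      ENNReal.ofReal_inv_of_pos (by norm_num), ENNReal.ofReal_inv_of_pos hp,
      ENNReal.ofReal_pow (Nat.cast_nonneg n), ENNReal.ofReal_natCast]
    norm_num
  · rw [← hsum fun k => |weight μ (block s i') k - ((block s i).card : ℝ)⁻¹|]
    unfold cellError
    rw [hcard]
    have e1 : 0 ≤ D * (((block s i).filter fun i => width s (i j) = 1).card /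
      (n : ℝ) ^ (d - 1)) := by positivity
    have e2 : 0 ≤ D * (((block s i').filter fun i => width s (i j) = 1).card /
      (n : ℝ) ^ (d - 1)) := by positivity
    linarith

end PairEstimate

/-! ### Summation over all interfaces -/

section Summation

variable {d n : ℕ} {Y : Type*} [PseudoEMetricSpace Y] [MeasurableSpace Y]
  {μ : Measure (E d)} {π : Measure (E d × Y)}

/-- Multiplied by `m_J`, the weight error becomes the mass deviation; the lower bound on the masses
gives `|J|/m_J ≤ n^d/M`. -/
theorem card_mul_sum_abs_weight_le {M : ℝ} (hM : 0 < M) (hn : 0 < n)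
    (hm : ∀ i : Idx d n, M / (n : ℝ) ^ d ≤ (basicMass μ i).toReal) {J : Finset (Idx d n)}
    (hJ : J.Nonempty) :
    J.card * ∑ i ∈ J, |weight μ J i - (J.card : ℝ)⁻¹| ≤ (n : ℝ) ^ d / M *
      ∑ i ∈ J, |(J.card : ℝ)⁻¹ * ∑ i' ∈ J, (basicMass μ i').toReal - (basicMass μ i).toReal| := by
  have hn' : (0 : ℝ) < n := by exact_mod_cast hn
  have hc : (0 : ℝ) < J.card := by exact_mod_cast hJ.card_pos
  have hnd : (0 : ℝ) < (n : ℝ) ^ d := by positivity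
  set C := ∑ i' ∈ J, (basicMass μ i').toReal with hC
  have hlow : J.card * (M / (n : ℝ) ^ d) ≤ C := by
    rw [← nsmul_eq_mul, ← Finset.sum_const]
    exact Finset.sum_le_sum fun i _ => hm i
  have hC0 : 0 < C := lt_of_lt_of_le (by positivity) hlow
  have hle : J.card / C ≤ (n : ℝ) ^ d / M := by
    rw [div_le_div_iff₀ hC0 hM]
    have := mul_le_mul_of_nonneg_left hlow hnd.le
    calc J.card * M = (n : ℝ) ^ d * (J.card * (M / (n : ℝ) ^ d)) := by field_simp
      _ ≤ _ := this
  have heq : J.card * ∑ i ∈ J, |weight μ J i - (J.card : ℝ)⁻¹| = J.card / C *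
      ∑ i ∈ J, |(J.card : ℝ)⁻¹ * C - (basicMass μ i).toReal| := by
    rw [Finset.mul_sum, Finset.mul_sum]
    refine Finset.sum_congr rfl fun i _ => ?_
    have : (J.card : ℝ)⁻¹ * C - (basicMass μ i).toReal =
        C * -(weight μ J i - (J.card : ℝ)⁻¹) := by
      rw [weight, ← hC]
      field_simp
      ring
    rw [this, abs_mul, abs_neg, abs_of_pos hC0, ← mul_assoc, div_mul_cancel₀ _ hC0.ne']
  rw [heq]
  exact mul_le_mul_of_nonneg_right hle (Finset.sum_nonneg fun _ _ => abs_nonneg _)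

theorem sum_cellError_le [IsProbabilityMeasure μ] (hμ : μ ≪ volume) (hd : 1 ≤ d)
    {Ω : Set (E d)} (hΩ : interior (unitCube d) ⊆ Ω) (hBV : totalVariation Ω (density μ) ≠ ∞)
    {M : ℝ} (hM : 0 < M) (hn : 0 < n)
    (hm : ∀ i : Idx d n, M / (n : ℝ) ^ d ≤ (basicMass μ i).toReal) {D : ℝ} (hD : 0 ≤ D)
    (s : ℕ) (j : Fin d) :
    ∑ J ∈ shiftedPartition d n s, cellError D μ s j J ≤
      D * (d / M * (totalVariation Ω (density μ)).toReal + 2) := by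
  have hn' : (0 : ℝ) < n := by exact_mod_cast hn
  have hp : (0 : ℝ) < (n : ℝ) ^ (d - 1) := by positivity
  have hpow : (n : ℝ) ^ d = n ^ (d - 1) * n := by
    rw [← pow_succ, Nat.sub_add_cancel hd]
  set TV := (totalVariation Ω (density μ)).toReal
  have h1 : ∑ J ∈ shiftedPartition d n s, (J.card : ℝ) *
      ∑ i ∈ J, |weight μ J i - (J.card : ℝ)⁻¹| ≤ (n : ℝ) ^ (d - 1) / M * (2 * d * TV) := by
    calc _ ≤ ∑ J ∈ shiftedPartition d n s, (n : ℝ) ^ d / M * ∑ i ∈ J, |(J.card : ℝ)⁻¹ *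
          ∑ i' ∈ J, (basicMass μ i').toReal - (basicMass μ i).toReal| := by
          refine Finset.sum_le_sum fun J hJ => card_mul_sum_abs_weight_le hM hn hm ?_
          obtain ⟨i, rfl⟩ := mem_shiftedPartition.1 hJ
          exact ⟨i, self_mem_block s i⟩
      _ = (n : ℝ) ^ (d - 1) / M * (n * ∑ J ∈ shiftedPartition d n s, ∑ i ∈ J, |(J.card : ℝ)⁻¹ *
          ∑ i' ∈ J, (basicMass μ i').toReal - (basicMass μ i).toReal|) := by
          rw [← Finset.mul_sum, hpow]
          ring
      _ ≤ _ := by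
          exact mul_le_mul_of_nonneg_left (sum_mass_deviation_le hμ hΩ hBV hn s) (by positivity)
  have h2 : ∑ J ∈ shiftedPartition d n s, ((J.filter fun i => width s (i j) = 1).card : ℝ) ≤
      2 * (n : ℝ) ^ (d - 1) := by
    refine le_trans (le_of_eq ?_) (card_width_eq_one_le s j)
    have := sum_shiftedPartition s fun i : Idx d n => if width s (i j) = 1 then (1 : ℝ) else 0
    simpa only [Finset.sum_boole] using this
  have h3 : ∑ J ∈ shiftedPartition d n s, cellError D μ s j J = D * ((∑ J ∈ shiftedPartition d n s,
      (J.card : ℝ) * ∑ i ∈ J, |weight μ J i - (J.card : ℝ)⁻¹|) / (2 * (n : ℝ) ^ (d - 1)) +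
      (∑ J ∈ shiftedPartition d n s, ((J.filter fun i => width s (i j) = 1).card : ℝ)) /
        (n : ℝ) ^ (d - 1)) := by
    unfold cellError
    rw [← Finset.mul_sum, Finset.sum_add_distrib, Finset.sum_div, Finset.sum_div]
    congr 2
    refine Finset.sum_congr rfl fun J _ => ?_
    field_simp
  rw [h3]
  refine mul_le_mul_of_nonneg_left (add_le_add ?_ ?_) hD
  · rw [div_le_iff₀ (by positivity)]
    refine h1.trans (le_of_eq ?_)
    ring
  · rw [div_le_iff₀ hp]
    exact h2

theorem sum_ite_le_of_unique {ι : Type*} {P : Finset ι} {p : ι → Prop} [DecidablePred p]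
    (h : ∀ a ∈ P, ∀ b ∈ P, p a → p b → a = b) (c : ℝ≥0∞) :
    ∑ a ∈ P, (if p a then c else 0) ≤ c := by
  by_cases hex : ∃ a ∈ P, p a
  · obtain ⟨a, ha, hpa⟩ := hex
    rw [Finset.sum_eq_single_of_mem a ha fun b hb hne => if_neg fun hpb => hne (h b hb a ha hpb hpa),
      if_pos hpa]
  · push Not at hex
    rw [Finset.sum_eq_zero fun a ha => if_neg (hex a ha)]
    exact zero_le

open Classical in
-- In direction `j` a cell has at most one successor and at most one predecessor, so every term is
-- used at most once.
theorem sum_isNext_le {s : ℕ} (j : Fin d) (f g g' : Finset (Idx d n) → ℝ≥0∞) :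
    ∑ J ∈ shiftedPartition d n s, ∑ J' ∈ shiftedPartition d n s,
      (if IsNext s j J J' then f J + g J + g' J' else 0) ≤
    ∑ J ∈ shiftedPartition d n s, f J + ∑ J ∈ shiftedPartition d n s, g J +
      ∑ J ∈ shiftedPartition d n s, g' J := by
  have hsplit : ∀ J J' : Finset (Idx d n), (if IsNext s j J J' then f J + g J + g' J' else 0) =
      (if IsNext s j J J' then f J + g J else 0) + if IsNext s j J J' then g' J' else 0 :=
    fun J J' => by split_ifs <;> simp
  simp only [hsplit]
  simp only [Finset.sum_add_distrib (s := shiftedPartition d n s)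
    (g := fun J' => if IsNext s j _ J' then g' J' else 0)]
  rw [Finset.sum_add_distrib, ← Finset.sum_add_distrib (f := f)]
  refine add_le_add (Finset.sum_le_sum fun J hJ => ?_) ?_
  · exact sum_ite_le_of_unique (fun a ha b hb h1 h2 => h1.unique_right hJ ha hb h2) _
  · rw [Finset.sum_comm]
    exact Finset.sum_le_sum fun J hJ =>
      sum_ite_le_of_unique (fun a ha b hb h1 h2 => h1.unique_left hJ ha hb h2) _

theorem sum_skipCost_le :
    2⁻¹ * ((n : ℝ≥0∞) ^ (d - 1))⁻¹ * ∑ j, ∑ i : Idx d n, skipCost μ π j i ≤ 2⁻¹ * wtvb n μ π := by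
  classical
  rw [wtvb, mul_assoc]
  gcongr 2⁻¹ * (_ * ?_)
  unfold skipCost
  rw [Finset.sum_comm]
  refine Finset.sum_le_sum fun i _ => ?_
  rw [Finset.sum_comm]
  refine Finset.sum_le_sum fun i' _ => ?_
  split_ifs with h
  · refine sum_ite_le_of_unique (fun a _ b _ ha hb => ?_) _
    by_contra hne
    have := congrFun (ha.symm.trans hb) a
    simp [hne] at this
  · push Not at h
    rw [Finset.sum_eq_zero fun j _ => if_neg (h j)]

theorem wtv_le [OpensMeasurableSpace Y] [SecondCountableTopology Y] [IsProbabilityMeasure μ]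
    (hμ : μ ≪ volume) (hd : 1 ≤ d)
    {Ω : Set (E d)} (hΩ : interior (unitCube d) ⊆ Ω) (hBV : totalVariation Ω (density μ) ≠ ∞)
    {M : ℝ} (hM : 0 < M) (hn : 0 < n)
    (hm : ∀ i : Idx d n, M / (n : ℝ) ^ d ≤ (basicMass μ i).toReal)
    {D : ℝ} (hD0 : 0 ≤ D) (hD : ∀ x y : Y, edist x y ≤ ENNReal.ofReal D)
    (πs : ℕ → Measure (E d × Y)) (k : ℕ)
    (hρ : ∀ i : Idx d n, IsProbabilityMeasure (basicRho μ (πs k) i)) :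
    wtv n μ πs ((k : ℝ) / n) ≤ 2⁻¹ * wtvb n μ (πs k) +
      ENNReal.ofReal (d * (2 * (D * (d / M * (totalVariation Ω (density μ)).toReal + 2)))) := by
  classical
  have hn' : (0 : ℝ) < n := by exact_mod_cast hn
  have hm' : ∀ i : Idx d n, 0 < (basicMass μ i).toReal := fun i =>
    lt_of_lt_of_le (by positivity) (hm i)
  obtain ⟨s, hs⟩ := exists_iterPartition_eq d n k
  set P := shiftedPartition d n s with hP
  set π := πs k with hπ
  set T : Finset (Idx d n) → Finset (Idx d n) → ℝ≥0∞ := fun J J' =>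
    interfaceArea J J' * wasserstein (compositeRho μ π J) (compositeRho μ π J') with hT
  have hTc : ∀ J J', T J J' = T J' J := fun J J' => by
    simp only [hT]
    rw [interfaceArea_comm, wasserstein_comm]
  -- `A` orients the pairs. An adjacent pair appears in `A J J'` or in `A J' J`, so symmetrizing
  -- absorbs the factor `1/2` of the sum over ordered pairs.
  set A : Finset (Idx d n) → Finset (Idx d n) → ℝ≥0∞ := fun J J' =>
    ∑ j, if IsNext s j J J' then T J J' else 0 with hA
  have hpt : ∀ J ∈ P, ∀ J' ∈ P, (if Adjacent J J' then T J J' else 0) ≤ A J J' + A J' J := by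
    intro J hJ J' hJ'
    split_ifs with hadj
    · obtain ⟨j, h | h⟩ := hadj.exists_isNext hd hJ hJ'
      · refine le_add_right (le_trans (le_of_eq ?_) (Finset.single_le_sum (fun _ _ => zero_le)
          (Finset.mem_univ j)))
        rw [if_pos h]
      · refine le_add_left (le_trans (le_of_eq ?_) (Finset.single_le_sum (fun _ _ => zero_le)
          (Finset.mem_univ j)))
        rw [if_pos h, hTc]
    · exact zero_le
  have hwtv : wtv n μ πs ((k : ℝ) / n) =
      2⁻¹ * ∑ J ∈ P, ∑ J' ∈ P, if Adjacent J J' then T J J' else 0 := by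
    have hk : ⌊(k : ℝ) / n * n⌋₊ = k := by rw [div_mul_cancel₀ _ hn'.ne', Nat.floor_natCast]
    unfold wtv
    simp only [hk, hs]
    rfl
  have hhalf : wtv n μ πs ((k : ℝ) / n) ≤ ∑ J ∈ P, ∑ J' ∈ P, A J J' := by
    rw [hwtv]
    calc _ ≤ 2⁻¹ * ∑ J ∈ P, ∑ J' ∈ P, (A J J' + A J' J) := by
          gcongr with J hJ J' hJ'
          exact hpt J hJ J' hJ'
      _ = 2⁻¹ * (2 * ∑ J ∈ P, ∑ J' ∈ P, A J J') := by
          simp only [Finset.sum_add_distrib]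
          rw [Finset.sum_comm (f := fun J J' => A J' J), two_mul]
      _ = _ := by
          rw [← mul_assoc, ENNReal.inv_mul_cancel two_ne_zero ENNReal.ofNat_ne_top, one_mul]
  have hswap : ∑ J ∈ P, ∑ J' ∈ P, A J J' =
      ∑ j, ∑ J ∈ P, ∑ J' ∈ P, if IsNext s j J J' then T J J' else 0 := by
    simp only [hA]
    rw [Finset.sum_comm]
    simp only [Finset.sum_comm (s := P) (t := Finset.univ)]
    rw [Finset.sum_congr rfl fun j _ => Finset.sum_comm]
  set e : Fin d → Finset (Idx d n) → ℝ≥0∞ := fun j J => ENNReal.ofReal (cellError D μ s j J)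
  set q : ℝ≥0∞ := 2⁻¹ * ((n : ℝ≥0∞) ^ (d - 1))⁻¹ with hq
  set R : ℝ := D * (d / M * (totalVariation Ω (density μ)).toReal + 2)
  have hR : 0 ≤ R := by positivity
  have he : ∀ j, ∑ J ∈ P, e j J ≤ ENNReal.ofReal R := fun j => by
    rw [← ENNReal.ofReal_sum_of_nonneg fun J _ => cellError_nonneg hD0 s j J]
    exact ENNReal.ofReal_le_ofReal (sum_cellError_le hμ hd hΩ hBV hM hn hm hD0 s j)
  have hj : ∀ j, ∑ J ∈ P, ∑ J' ∈ P, (if IsNext s j J J' then T J J' else 0) ≤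
      q * ∑ i, skipCost μ π j i + ENNReal.ofReal (2 * R) := fun j => by
    calc _ ≤ ∑ J ∈ P, ∑ J' ∈ P, (if IsNext s j J J' then
          q * ∑ i ∈ J, skipCost μ π j i + e j J + e j J' else 0) := by
          refine Finset.sum_le_sum fun J hJ => Finset.sum_le_sum fun J' hJ' => ?_
          split_ifs with h
          · exact h.cost_le hd hD0 hD hm' hρ hJ hJ'
          · exact le_rfl
      _ ≤ ∑ J ∈ P, q * ∑ i ∈ J, skipCost μ π j i + ∑ J ∈ P, e j J + ∑ J ∈ P, e j J :=
          sum_isNext_le j _ _ _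
      _ ≤ q * ∑ i, skipCost μ π j i + ENNReal.ofReal R + ENNReal.ofReal R := by
          rw [← Finset.mul_sum, sum_shiftedPartition]
          exact add_le_add (add_le_add le_rfl (he j)) (he j)
      _ = _ := by rw [add_assoc, ← ENNReal.ofReal_add hR hR, two_mul]
  calc _ ≤ ∑ j, (q * ∑ i, skipCost μ π j i + ENNReal.ofReal (2 * R)) :=
        hhalf.trans (hswap.le.trans (Finset.sum_le_sum fun j _ => hj j))
    _ = q * ∑ j, ∑ i, skipCost μ π j i + ENNReal.ofReal (d * (2 * R)) := by
        rw [Finset.sum_add_distrib, ← Finset.mul_sum, Finset.sum_const, Finset.card_univ,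
          Fintype.card_fin, nsmul_eq_mul, ENNReal.ofReal_mul (Nat.cast_nonneg d),
          ENNReal.ofReal_natCast]
    _ ≤ _ := add_le_add sum_skipCost_le le_rfl

/-- After division by `√d` and squaring, this is `4d ≤ 4^d`. -/
theorem two_mul_le_two_pow_mul_sqrt (hd : 1 ≤ d) : 2 * (d : ℝ) ≤ 2 ^ d * √(d : ℝ) := by
  have h4 : ∀ m : ℕ, 1 ≤ m → 4 * m ≤ 4 ^ m := by
    intro m hm
    induction m, hm using Nat.le_induction with
    | base => norm_num
    | succ m hm ih => rw [pow_succ]; omega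
  have h4' : 4 * (d : ℝ) ≤ (2 ^ d) ^ 2 := by
    rw [← pow_mul, mul_comm d 2, pow_mul]
    norm_num
    exact_mod_cast h4 d hd
  have h2 : 2 * √(d : ℝ) ≤ 2 ^ d := by
    refine le_of_sq_le_sq ?_ (by positivity)
    rw [mul_pow, Real.sq_sqrt (Nat.cast_nonneg d)]
    linarith
  calc 2 * (d : ℝ) = 2 * √(d : ℝ) * √(d : ℝ) := by
        rw [mul_assoc, Real.mul_self_sqrt (Nat.cast_nonneg d)]
    _ ≤ _ := by gcongr

end Summation

end DomDec

/-! ### The proposition, with the constants simplified -/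

theorem mainTheorem9 {d : ℕ} (hd : 1 ≤ d)
    {Y : Set (DomDec.E d)} (hY : IsCompact Y)
    (μ : Measure (DomDec.E d)) [IsProbabilityMeasure μ]
    (hμX : μ (DomDec.unitCube d)ᶜ = 0) (hμ : μ ≪ volume)
    (M_l : ℝ) (hM : 0 < M_l)
    (hlow : ∀ᵐ x ∂(volume.restrict (DomDec.unitCube d)), M_l ≤ DomDec.density μ x)
    (Ω : Set (DomDec.E d)) (hΩ : Ω = Set.univ ∨ Ω = interior (DomDec.unitCube d))
    (hBV : DomDec.totalVariation Ω (DomDec.density μ) ≠ ∞)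
    (n : ℕ) (hn : Even n) (hn0 : 0 < n)
    (μn : Measure (DomDec.E d)) [IsProbabilityMeasure μn]
    (hμnX : μn (DomDec.unitCube d)ᶜ = 0)
    (hμn : ∀ i : DomDec.Idx d n, μn (DomDec.basicCell i) = DomDec.basicMass μ i)
    (hμn_bdry : ∀ i : DomDec.Idx d n, μn (frontier (DomDec.basicCell i)) = 0)
    (νn : Measure Y) [IsProbabilityMeasure νn]
    (c : DomDec.E d × Y → ℝ) (hc : Measurable c)
    (hcb : ∃ C : ℝ, ∀ p ∈ DomDec.unitCube d ×ˢ (Set.univ : Set Y), |c p| ≤ C)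
    (ε : ℝ≥0)
    (πs : ℕ → Measure (DomDec.E d × Y))
    (hπ : DomDec.IsDomDecIterates n c ε μn νn πs)
    (k : ℕ) :
    DomDec.wtv n μ πs ((k : ℝ) / n) ≤
      2⁻¹ * DomDec.wtvb n μ (πs k) +
        ENNReal.ofReal ((d : ℝ) * Metric.diam Y *
          (2 ^ (2 * d) + 2 ^ d * (√(d : ℝ) / M_l) *
            (DomDec.totalVariation Ω (DomDec.density μ)).toReal)) := by
  -- The test fields are supported in the open cube, so both choices of `Ω` are covered by this
  -- inclusion.
  have hsub : interior (DomDec.unitCube d) ⊆ Ω := by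
    rcases hΩ with rfl | rfl
    · exact subset_univ _
    · exact subset_rfl
  have hm : ∀ i : DomDec.Idx d n, M_l / (n : ℝ) ^ d ≤ (DomDec.basicMass μ i).toReal :=
    DomDec.le_basicMass hμ hM hlow
  have hn' : (0 : ℝ) < n := by exact_mod_cast hn0
  have hρ : ∀ i : DomDec.Idx d n, IsProbabilityMeasure (DomDec.basicRho μ (πs k) i) := fun i =>
    DomDec.isProbabilityMeasure_basicRho (lt_of_lt_of_le (by positivity) (hm i))
      ((hπ.partialMarginal_univ hμn_bdry k i).trans (hμn i))
  have hD : ∀ x y : Y, edist x y ≤ ENNReal.ofReal (Metric.diam Y) := fun x y => by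
    rw [edist_dist]
    exact ENNReal.ofReal_le_ofReal (Metric.dist_le_diam_of_mem hY.isBounded x.2 y.2)
  refine (DomDec.wtv_le hμ hd hsub hBV hM hn0 hm Metric.diam_nonneg hD πs k hρ).trans ?_
  refine add_le_add le_rfl (ENNReal.ofReal_le_ofReal ?_)
  set TV := (DomDec.totalVariation Ω (DomDec.density μ)).toReal
  have hTV : 0 ≤ TV := ENNReal.toReal_nonneg
  have h1 : (4 : ℝ) ≤ 2 ^ (2 * d) := by
    calc (4 : ℝ) = 2 ^ 2 := by norm_num
      _ ≤ _ := pow_le_pow_right₀ (by norm_num) (by omega)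
  have h2 : 2 * (d / M_l * TV) ≤ 2 ^ d * (√(d : ℝ) / M_l) * TV := by
    have := mul_le_mul_of_nonneg_right (DomDec.two_mul_le_two_pow_mul_sqrt hd)
      (div_nonneg hTV hM.le)
    calc 2 * (d / M_l * TV) = 2 * d * (TV / M_l) := by ring
      _ ≤ _ := this
      _ = _ := by ring
  have h0 : 0 ≤ (d : ℝ) * Metric.diam Y := mul_nonneg (Nat.cast_nonneg d) Metric.diam_nonneg
  calc _ = (d : ℝ) * Metric.diam Y * (4 + 2 * (d / M_l * TV)) := by ring
    _ ≤ _ := mul_le_mul_of_nonneg_left (add_le_add h1 h2) h0
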